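/- **Setting.** Let $n,d\ge 1$, $\sigma,\varepsilon>0$, $M\ge 0$, $0<\delta<1$, $R,D\in\mathbb R$; $\|\cdot\|$ is the Euclidean norm on $\mathbb R^n$ and $B_r(x)$ the closed ball. Let $Q_0$ be a probability measure on $\mathbb R^n$ with $Q_0(B_D(0))=1$, and let $\mathcal C=\{\hat\mu_1,\dots,\hat\mu_{k'}\}\subset\mathbb R^n$ be $k'$ distinct points forming a complete set of $R$-warm starts for $Q_0$, i.e. $Q_0\big(\bigcup_j B_R(\hat\mu_j)\big)=1$, with $d\ge (R/\sigma)^2$. Let $V_j=\{x:\|x-\hat\mu_j\|=\min_{j'}\|x-\hat\mu_{j'}\|\}$ be the Voronoi cells. Let $Y=\mu+\xi$ with $\mu\sim Q_0$ and $\xi\sim\mathcal N(0,\sigma^2I_n)$ independent, let $P=Q_0*\mathcal N(0,\sigma^2I_n)$ be the law of $Y$, and let $$f(y)=\mathbb E[\mu\mid Y=y]=\frac{\int \mu\, e^{\langle y,\mu\rangle/\sigma^2-\|\mu\|^2/(2\sigma^2)}\,dQ_0(\mu)}{\int e^{\langle y,\mu\rangle/\sigma^2-\|\mu\|^2/(2\sigma^2)}\,dQ_0(\mu)}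 .$$ For a multi-index $\mathbf k\in\mathbb N_0^n$ put $|\mathbf k|=\sum_i\mathbf k_i$ and let $h_{\mathbf k}(z)=\prod_{i} \mathrm{He}_{\mathbf k_i}(z_i/\sigma)/\sqrt{\mathbf k_i!}$ be the Hermite polynomials orthonormal in $L^2(\mathcal N(0,\sigma^2I_n))$, where $\mathrm{He}_0=1$ and $\mathrm{He}_{m+1}(x)=x\,\mathrm{He}_m(x)-\mathrm{He}_m'(x)$. Coefficient vectors are $b=(b_{\mathbf k})_{|\mathbf k|\le d}$ with $b_{\mathbf k}\in\mathbb R^n$, $B_M=\{b:\sum_{\mathbf k}\|b_{\mathbf k}\|^2\le M^2\}$, and $p_b(z)=\sum_{|\mathbf k|\le d}b_{\mathbf k}h_{\mathbf k}(z)$. Let $(\mu_i,y_i)$, $i=1,\dots,\mathcal N$, be i.i.d. copies of $(\mu,Y)$. For each cell $j$ define $$\hat L^{(j)}(b)=\frac1{\mathcal N}\sum_{i:\,y_i\in V_j}\|p_b(y_i-\hat\mu_j)-\mu_i\|^2,\qquad L^{(j)}(b)=\mathbb E\big[\mathbf 1_{V_j}(Y)\,\|p_b(Y-\hat\mu_j)-\mu\|^2\big],$$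 and, with $z_i=f(y_i)$, $\eta_i=\mu_i-z_i$, $\eta=\mu-f(Y)$, the shifted error (the terms of $\hat L^{(j)}-L^{(j)}$ that do not depend on $b$ and consist of noise only are removed) $$\operatorname{err}^{(j)}(b)=(\hat L^{(j)}-L^{(j)})(b)-\frac2{\mathcal N}\sum_{i:\,y_i\in V_j}\langle z_i,\eta_i\rangle-\Big(\frac1{\mathcal N}\sum_{i:\,y_i\in V_j}\|\eta_i\|^2-\mathbb E\big[\mathbf 1_{V_j}(Y)\|\eta\|^2\big]\Big).$$ For $b=(b^{(1)},\dots,b^{(k')})$ let $g_b(y)=\sum_{j}\mathbf 1_{V_j}(y)\,p_{b^{(j)}}(y-\hat\mu_j)$. **Lemma (Generalization gap).** There is a universal constant $C>0$ such that, in the above setting, if $$\mathcal N\ \ge\ \frac{n\,\big(k'(1+M+D)^2\big)^2\,\big(C\,\ln(2k'/\delta)\,\sqrt{n/d+1}\,\big)^{4(d+1)}}{\varepsilon^4},$$ then $g_b-f\in L^2(P)$ for all $b$, and with probability at least $1-\delta$ over the samples all of the following hold simultaneously: 1. for every cell $j$, $\ \max_{b\in B_M}|\operatorname{err}^{(j)}(b)|\le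 \varepsilon^2/k'$; 2. for every $\hat b$ such that, for each $j$, $\hat b^{(j)}$ minimizes $\hat L^{(j)}$ over $B_M$, and every $\tilde b$ with $\tilde b^{(j)}\in B_M$ for each $j$, the functions $\hat g=g_{\hat b}$ and $\tilde g=g_{\tilde b}$ satisfy $$\|\hat g-f\|_{L^2(P)}^2-\|\tilde g-f\|_{L^2(P)}^2\le\varepsilon^2 .$$ -/

import Mathlib

open MeasureTheory ProbabilityTheory
open scoped Nat RealInnerProductSpace

noncomputable section

namespace PiecewiseRegression

/-- `ℝⁿ` with its Euclidean norm. -/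
abbrev Vec (n : ℕ) : Type := EuclideanSpace ℝ (Fin n)

/-! ### Normalized Hermite polynomials and coefficient vectors -/

/-- Univariate Hermite polynomial of degree `k` for the variance `σ ^ 2`, normalized so that it has
unit norm in `L²(𝒩(0, σ²))`. Mathlib's `Polynomial.hermite` is the probabilists' family, with
`He₀ = 1` and `Heₖ₊₁ = X Heₖ - Heₖ'`, whose squared norm under `𝒩(0, 1)` is `k!`. -/
def hermiteOne (σ : ℝ) (k : ℕ) (x : ℝ) : ℝ :=
  Polynomial.aeval (x / σ) (Polynomial.hermite k) / √(k ! : ℝ)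

/-- Multi-indices `k ∈ ℕⁿ` with `|k| = k₁ + ⋯ + kₙ ≤ d` (each entry is then at most `d`). -/
abbrev MultiIdx (n d : ℕ) : Type :=
  {k : Fin n → Fin (d + 1) // ∑ i, (k i : ℕ) ≤ d}

/-- Multivariate Hermite polynomial `h_k(z) = ∏ᵢ h_{kᵢ}(zᵢ)`. -/
def hermiteMulti {n d : ℕ} (σ : ℝ) (k : MultiIdx n d) (z : Vec n) : ℝ :=
  ∏ i, hermiteOne σ (k.1 i : ℕ) (z i)

/-- Coefficient vectors `(b_k)_{|k| ≤ d}` with `b_k ∈ ℝⁿ`, with the Euclidean norm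
`(∑ₖ ‖b_k‖²)^{1/2}`. -/
abbrev Coeffs (n d : ℕ) : Type := PiLp 2 (fun _ : MultiIdx n d => Vec n)

/-- The `ℝⁿ`-valued polynomial `∑_{|k| ≤ d} b_k h_k(z)`. -/
def hermiteSum {n d : ℕ} (σ : ℝ) (b : Coeffs n d) (z : Vec n) : Vec n :=
  ∑ k, hermiteMulti σ k z • b k

/-! ### Gaussian mixture, posterior mean, warm starts, Voronoi cells -/

/-- The noise distribution `𝒩(0, σ² Iₙ)`. -/
def noiseLaw (n : ℕ) (σ : ℝ) : Measure (Vec n) :=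
  (stdGaussian (Vec n)).map (fun x => σ • x)

/-- The joint law of `(μ, Y)`, `Y = μ + ξ`, with `μ ∼ Q₀` and `ξ ∼ 𝒩(0, σ² Iₙ)` independent. -/
def denoisingLaw {n : ℕ} (Q₀ : Measure (Vec n)) (σ : ℝ) : Measure (Vec n × Vec n) :=
  (Q₀.prod (noiseLaw n σ)).map (fun p => (p.1, p.1 + p.2))

/-- The mixture `P = Q₀ * 𝒩(0, σ² Iₙ)`, the law of `Y`. -/
def mixtureLaw {n : ℕ} (Q₀ : Measure (Vec n)) (σ : ℝ) : Measure (Vec n) :=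
  Q₀.conv (noiseLaw n σ)

/-- Unnormalized posterior density `exp(⟨y, μ⟩ / σ² - ‖μ‖² / (2σ²))` of `μ` given `Y = y`, with
respect to `Q₀`. -/
def posteriorWeight {n : ℕ} (σ : ℝ) (y μ : Vec n) : ℝ :=
  Real.exp (⟪y, μ⟫ / σ ^ 2 - ‖μ‖ ^ 2 / (2 * σ ^ 2))

/-- The target `f(y) = 𝔼[μ | Y = y] = y + σ² ∇ log p(y)` (`p` the density of the mixture),
given by its Bayes formula. -/
def posteriorMean {n : ℕ} (Q₀ : Measure (Vec n)) (σ : ℝ) (y : Vec n) : Vec n :=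
  (∫ μ, posteriorWeight σ y μ ∂Q₀)⁻¹ • ∫ μ, posteriorWeight σ y μ • μ ∂Q₀

/-- The centers `c₁, …, c_K` form a complete set of `R`-warm starts for `Q₀`. -/
def IsCompleteWarmStarts {n K : ℕ} (Q₀ : Measure (Vec n)) (c : Fin K → Vec n) (R : ℝ) : Prop :=
  Q₀ (⋃ j, Metric.closedBall (c j) R) = 1

/-- The Voronoi cell of the `j`-th center. -/
def voronoiCell {n K : ℕ} (c : Fin K → Vec n) (j : Fin K) : Set (Vec n) :=
  {x | ∀ j', ‖x - c j‖ ≤ ‖x - c j'‖}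

/-! ### Risks, empirical risk minimizer, shifted error

A sample is a vector `s` of pairs `s i = (μᵢ, yᵢ)`. -/

/-- Empirical denoising loss in the `j`-th cell:
`(1/N) ∑_{i : yᵢ ∈ V_j} ‖∑ₖ b_k h_k(yᵢ - c_j) - μᵢ‖²`. -/
def empiricalRisk {n d K N : ℕ} (c : Fin K → Vec n) (σ : ℝ) (j : Fin K)
    (s : Fin N → Vec n × Vec n) (b : Coeffs n d) : ℝ :=
  (1 / (N : ℝ)) * ∑ i, (voronoiCell c j).indicator
    (fun y => ‖hermiteSum σ b (y - c j) - (s i).1‖ ^ 2) (s i).2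

/-- Population loss in the `j`-th cell: `𝔼[𝟙_{V_j}(Y) ‖∑ₖ b_k h_k(Y - c_j) - μ‖²]`. -/
def populationRisk {n d K : ℕ} (Q₀ : Measure (Vec n)) (c : Fin K → Vec n) (σ : ℝ) (j : Fin K)
    (b : Coeffs n d) : ℝ :=
  ∫ p, (voronoiCell c j).indicator
    (fun y => ‖hermiteSum σ b (y - c j) - p.1‖ ^ 2) p.2 ∂(denoisingLaw Q₀ σ)

/-- `b` minimizes the empirical loss of the `j`-th cell over the closed ball `B_M`. -/
def IsERM {n d K N : ℕ} (c : Fin K → Vec n) (σ M : ℝ) (j : Fin K)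
    (s : Fin N → Vec n × Vec n) (b : Coeffs n d) : Prop :=
  b ∈ Metric.closedBall (0 : Coeffs n d) M ∧
    ∀ b' ∈ Metric.closedBall (0 : Coeffs n d) M,
      empiricalRisk c σ j s b ≤ empiricalRisk c σ j s b'

/-- The shifted error of the `j`-th cell. Writing `zᵢ = f(yᵢ)` and `ηᵢ = μᵢ - zᵢ`, it is the
empirical minus the population loss, minus the part that does not depend on `b`:
`(L̂ - L)(b) - (2/N) ∑_{yᵢ ∈ V_j} ⟨zᵢ, ηᵢ⟩ - ((1/N) ∑_{yᵢ ∈ V_j} ‖ηᵢ‖² - 𝔼[𝟙_{V_j}(Y) ‖η‖²])`. -/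
def shiftedErr {n d K N : ℕ} (Q₀ : Measure (Vec n)) (c : Fin K → Vec n) (σ : ℝ) (j : Fin K)
    (s : Fin N → Vec n × Vec n) (b : Coeffs n d) : ℝ :=
  (empiricalRisk c σ j s b - populationRisk Q₀ c σ j b)
    - (2 / (N : ℝ)) * ∑ i, (voronoiCell c j).indicator
        (fun y => ⟪posteriorMean Q₀ σ y, (s i).1 - posteriorMean Q₀ σ y⟫) (s i).2
    - ((1 / (N : ℝ)) * ∑ i, (voronoiCell c j).indicator
          (fun y => ‖(s i).1 - posteriorMean Q₀ σ y‖ ^ 2) (s i).2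
        - ∫ p, (voronoiCell c j).indicator
          (fun y => ‖p.1 - posteriorMean Q₀ σ y‖ ^ 2) p.2 ∂(denoisingLaw Q₀ σ))

/-- The piecewise polynomial `y ↦ ∑ⱼ 𝟙_{V_j}(y) ∑ₖ b_k^{(j)} h_k(y - c_j)`. -/
def piecewisePoly {n d K : ℕ} (c : Fin K → Vec n) (σ : ℝ) (b : Fin K → Coeffs n d)
    (y : Vec n) : Vec n :=
  ∑ j, (voronoiCell c j).indicator (fun y => hermiteSum σ (b j) (y - c j)) y

/-- The `L²(P)` distance `‖g - f‖_{L²(P)}` of the piecewise polynomial `g` with coefficients `b`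
to `f`, where `P` is the mixture. -/
def l2Dist {n d K : ℕ} (Q₀ : Measure (Vec n)) (c : Fin K → Vec n) (σ : ℝ)
    (b : Fin K → Coeffs n d) : ℝ :=
  (eLpNorm (fun y => piecewisePoly c σ b y - posteriorMean Q₀ σ y) 2 (mixtureLaw Q₀ σ)).toReal

end PiecewiseRegression

end

open PiecewiseRegression

/-!
Expanding the square `‖p_b(y - c_j) - μ‖²` and removing the noise terms `2⟨z, η⟩ + ‖η‖²` leaves
`‖p_b‖² - 2⟨p_b, μ⟩ + ‖z‖²`, which is linear in a feature vector with entries `h_k h_l`, `h_k μᵢ`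
and `‖z‖²`, where `z = f(y)`. Since the residual `η = μ - f(Y)` is orthogonal to functions of `Y`
(`integral_inner_sub_posteriorMean`), the shifted error is the inner product of a coefficient
vector, of norm at most `(1 + M + D)²` on `B_M`, with the deviation of the empirical mean of the
features from its expectation (`shiftedErr_eq_inner`). By Cauchy-Schwarz, uniformity over `B_M`
reduces to one tail bound for the norm of this deviation in each cell.

The features have heavy tails, so the tail bound comes from moments of order `2q` with
`q ≈ log (2K / δ)`: for independent centered vectors of a Hilbert space,
`𝔼‖∑ Xᵢ‖^(2q) ≤ (16 q² N)^q max 𝔼‖Xᵢ‖^(2q)` (`integral_norm_sum_pow_le`), by induction on the number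
of summands from the second-order expansion `norm_add_pow_le`. The norm of the feature vector is at
most twice the energy `G(z) = ∑ₖ h_k(z)²`. For every small `r > 0`,
`G(z) ≤ r^(-d) exp (3r (‖z‖² / σ² + 2n))` (`hermiteEnergy_le`). In the cell of `c_j` the distance
of `Y` to `c_j` is at most its distance to the warm start of `μ`, hence at most `R + ‖ξ‖`, and
`R² ≤ d σ²`. Taking `r` proportional to `d / (q (n + d))` and using the exponential moments of
`‖ξ‖²` shows that the `q`-th moment of `G` on the cell is of order `(C q (n / d + 1))^(d q)`
(`integral_hermiteEnergy_pow_le`). Markov's inequality and a union bound over the cells conclude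
the first part, with room for a factor `2`.

For the second part, `‖g_b - f‖²` is, up to a constant, the sum of the population losses over the
cells, because the boundaries of the cells are null sets (`l2Dist_sq_eq_sum`,
`populationRisk_eq_add`). The terms removed from the error do not depend on `b`, so the excess risk
of an empirical minimizer is at most twice the uniform error in each cell (`l2Dist_sq_sub_le`).
-/

open PiecewiseRegression

namespace PiecewiseRegression

/-! ### A moment inequality for sums of independent vectors -/

section Moments

variable {H : Type*} [NormedAddCommGroup H] [InnerProductSpace ℝ H]

/-- Second-order expansion of `‖s + x‖ ^ (2 (p + 1))` around `s`, with an explicit remainder. -/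
lemma norm_add_pow_le (s x : H) (p : ℕ) :
    ‖s + x‖ ^ (2 * (p + 1)) ≤ ‖s‖ ^ (2 * (p + 1)) + 2 * (p + 1) * ⟪‖s‖ ^ (2 * p) • s, x⟫
      + 2 * (p + 1) ^ 2 * (‖x‖ ^ 2 * (‖s‖ + ‖x‖) ^ (2 * p)) := by
  rw [real_inner_smul_left]
  simp only [pow_mul]
  have hu : ‖s + x‖ ^ 2 = ‖s‖ ^ 2 + 2 * ⟪s, x⟫ + ‖x‖ ^ 2 := norm_add_sq_real s x
  have hc : |⟪s, x⟫| ≤ ‖s‖ * ‖x‖ := abs_real_inner_le_norm s x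
  have hw : ‖s + x‖ ^ 2 ≤ (‖s‖ + ‖x‖) ^ 2 := by
    gcongr
    exact norm_add_le s x
  have ha := norm_nonneg s
  have hb := norm_nonneg x
  have hu0 : 0 ≤ ‖s + x‖ ^ 2 := by positivity
  generalize ‖s + x‖ ^ 2 = u at *
  generalize ⟪s, x⟫ = c at *
  generalize ‖s‖ = a at *
  generalize ‖x‖ = b at *
  have hvw : a ^ 2 ≤ (a + b) ^ 2 := by gcongr; linarith
  have hcc : c * (2 * c + b ^ 2) ≤ 2 * b ^ 2 * (a + b) ^ 2 := by
    have h1 : c ^ 2 ≤ (a * b) ^ 2 := by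
      rw [← sq_abs c]
      gcongr
    have h2 : c * b ^ 2 ≤ (a * b) * b ^ 2 := by
      gcongr
      exact (le_abs_self c).trans hc
    nlinarith [mul_nonneg ha hb, mul_nonneg (mul_nonneg ha hb) (sq_nonneg b), sq_nonneg (b ^ 2)]
  -- with `u = ‖s + x‖²`, multiply the inequality for `p` by `u = a² + 2c + b²`
  induction p with
  | zero =>
    simp only [pow_zero, zero_add, pow_one, Nat.cast_zero]
    nlinarith [sq_nonneg b]
  | succ p ih =>
    have hvp : (a ^ 2) ^ p ≤ ((a + b) ^ 2) ^ p := by gcongr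
    have hvp1 : (a ^ 2) ^ (p + 1) ≤ ((a + b) ^ 2) ^ (p + 1) := by gcongr
    have hm := mul_le_mul_of_nonneg_right ih hu0
    have e1 : b ^ 2 * (a ^ 2) ^ (p + 1) ≤ b ^ 2 * ((a + b) ^ 2) ^ (p + 1) := by gcongr
    have e2 : (a ^ 2) ^ p * (c * (2 * c + b ^ 2)) ≤ 2 * (b ^ 2 * ((a + b) ^ 2) ^ (p + 1)) := by
      calc (a ^ 2) ^ p * (c * (2 * c + b ^ 2))
          ≤ (a ^ 2) ^ p * (2 * b ^ 2 * (a + b) ^ 2) := by gcongr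
        _ ≤ ((a + b) ^ 2) ^ p * (2 * b ^ 2 * (a + b) ^ 2) := by gcongr
        _ = _ := by ring
    have e3 : b ^ 2 * ((a + b) ^ 2) ^ p * u ≤ b ^ 2 * ((a + b) ^ 2) ^ (p + 1) := by
      calc b ^ 2 * ((a + b) ^ 2) ^ p * u ≤ b ^ 2 * ((a + b) ^ 2) ^ p * (a + b) ^ 2 := by gcongr
        _ = _ := by ring
    have hp : (0 : ℝ) ≤ p := Nat.cast_nonneg p
    have e4 := mul_le_mul_of_nonneg_left e2 (by positivity : (0 : ℝ) ≤ 2 * (p + 1))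
    have e5 := mul_le_mul_of_nonneg_left e3 (by positivity : (0 : ℝ) ≤ 2 * (p + 1) ^ 2)
    have e6 : 0 ≤ b ^ 2 * ((a + b) ^ 2) ^ (p + 1) := by positivity
    push_cast
    rw [pow_succ u (p + 1)]
    refine hm.trans ?_
    have expand : ((a ^ 2) ^ (p + 1) + 2 * (↑p + 1) * ((a ^ 2) ^ p * c)
        + 2 * (↑p + 1) ^ 2 * (b ^ 2 * ((a + b) ^ 2) ^ p)) * u
        = (a ^ 2) ^ (p + 1 + 1) + 2 * (p + 1 + 1) * ((a ^ 2) ^ (p + 1) * c)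
          + b ^ 2 * (a ^ 2) ^ (p + 1) + 2 * (p + 1) * ((a ^ 2) ^ p * (c * (2 * c + b ^ 2)))
          + 2 * (p + 1) ^ 2 * (b ^ 2 * ((a + b) ^ 2) ^ p * u) := by
      rw [hu]
      ring
    rw [expand]
    nlinarith

lemma add_pow_le_of_pos {a b θ : ℝ} (ha : 0 ≤ a) (hb : 0 ≤ b) (hθ : 0 < θ) (m : ℕ) :
    (a + b) ^ m ≤ (1 + θ) ^ m * (a ^ m + (b / θ) ^ m) := by
  have hbθ : b = θ * (b / θ) := by field_simp
  have hb' : 0 ≤ b / θ := by positivity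
  generalize b / θ = b' at *
  subst hbθ
  rcases le_total b' a with h | h
  · calc (a + θ * b') ^ m ≤ ((1 + θ) * a) ^ m := by gcongr; nlinarith
      _ = (1 + θ) ^ m * a ^ m := mul_pow _ _ _
      _ ≤ _ := by gcongr; exact le_add_of_nonneg_right (by positivity)
  · calc (a + θ * b') ^ m ≤ ((1 + θ) * b') ^ m := by gcongr; nlinarith
      _ = (1 + θ) ^ m * b' ^ m := mul_pow _ _ _
      _ ≤ _ := by gcongr; exact le_add_of_nonneg_left (by positivity)

lemma mul_pow_le_add_pow {x y : ℝ} (hx : 0 ≤ x) (hy : 0 ≤ y) (p : ℕ) :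
    x * y ^ p ≤ x ^ (p + 1) + y ^ (p + 1) := by
  rcases le_total x y with h | h
  · calc x * y ^ p ≤ y * y ^ p := by gcongr
      _ = y ^ (p + 1) := by ring
      _ ≤ _ := le_add_of_nonneg_left (by positivity)
  · calc x * y ^ p ≤ x * x ^ p := by gcongr
      _ = x ^ (p + 1) := by ring
      _ ≤ _ := le_add_of_nonneg_right (by positivity)

lemma one_add_inv_pow_le_two (p : ℕ) : (1 + 1 / (4 * ((p : ℝ) + 1))) ^ (2 * (p + 1)) ≤ 2 := by
  have h1 : 1 + 1 / (4 * ((p : ℝ) + 1)) ≤ Real.exp (1 / (4 * ((p : ℝ) + 1))) := by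
    rw [add_comm]
    exact Real.add_one_le_exp _
  calc (1 + 1 / (4 * ((p : ℝ) + 1))) ^ (2 * (p + 1))
      ≤ Real.exp (1 / (4 * ((p : ℝ) + 1))) ^ (2 * (p + 1)) := by gcongr
    _ = Real.exp (1 / 2) := by
      rw [← Real.exp_nat_mul]
      congr 1
      push_cast
      field_simp
      norm_num
    _ ≤ 2 := by
      rw [← Real.le_log_iff_exp_le (by norm_num)]
      linarith [Real.log_two_gt_d9]

/-- The remainder of `norm_add_pow_le` in terms of the pure powers of `a` and `b`, at any scale
`T ≥ 16 (p + 1)²`. -/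
lemma sq_mul_add_pow_le {a b T : ℝ} (ha : 0 ≤ a) (hb : 0 ≤ b) (p : ℕ)
    (hT : 16 * ((p : ℝ) + 1) ^ 2 ≤ T) :
    b ^ 2 * (a + b) ^ (2 * p) ≤
      T ^ p * (3 * b ^ (2 * (p + 1))) + 2 * a ^ (2 * (p + 1)) / T := by
  have hp : (0 : ℝ) ≤ p := Nat.cast_nonneg p
  have hT0 : 0 < T := lt_of_lt_of_le (by positivity) hT
  have h1 : b ^ 2 * (a + b) ^ (2 * p)
      ≤ T ^ p * ((b ^ 2) ^ (p + 1) + ((a + b) ^ 2 / T) ^ (p + 1)) := by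
    calc b ^ 2 * (a + b) ^ (2 * p) = T ^ p * (b ^ 2 * ((a + b) ^ 2 / T) ^ p) := by
          rw [div_pow, pow_mul]
          field_simp
      _ ≤ _ := by
          gcongr
          exact mul_pow_le_add_pow (by positivity) (by positivity) p
  have h2 : (a + b) ^ (2 * (p + 1)) ≤ 2 * (a ^ (2 * (p + 1)) + T ^ (p + 1) * b ^ (2 * (p + 1))) := by
    -- this value of `θ` keeps `(1 + θ) ^ (2 (p + 1)) ≤ 2`, while `θ⁻² = 16 (p + 1)² ≤ T`
    refine (add_pow_le_of_pos ha hb (θ := 1 / (4 * ((p : ℝ) + 1))) (by positivity) _).trans ?_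
    have h3 : (b / (1 / (4 * ((p : ℝ) + 1)))) ^ (2 * (p + 1)) ≤ T ^ (p + 1) * b ^ (2 * (p + 1)) := by
      calc (b / (1 / (4 * ((p : ℝ) + 1)))) ^ (2 * (p + 1))
          = (16 * ((p : ℝ) + 1) ^ 2) ^ (p + 1) * b ^ (2 * (p + 1)) := by
            rw [div_div_eq_mul_div, div_one, mul_pow, mul_comm, pow_mul (4 * ((p : ℝ) + 1))]
            ring_nf
        _ ≤ _ := by gcongr
    calc _ ≤ 2 * (a ^ (2 * (p + 1)) + (b / (1 / (4 * ((p : ℝ) + 1)))) ^ (2 * (p + 1))) := by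
          gcongr
          exact one_add_inv_pow_le_two p
      _ ≤ _ := by gcongr
  calc b ^ 2 * (a + b) ^ (2 * p)
      ≤ T ^ p * (b ^ (2 * (p + 1)) + (a + b) ^ (2 * (p + 1)) / T ^ (p + 1)) := by
        rw [div_pow, ← pow_mul, ← pow_mul] at h1
        exact h1
    _ ≤ T ^ p * (b ^ (2 * (p + 1)) +
          2 * (a ^ (2 * (p + 1)) + T ^ (p + 1) * b ^ (2 * (p + 1))) / T ^ (p + 1)) := by gcongr
    _ = _ := by
        field_simp
        ring

variable [MeasurableSpace H] [BorelSpace H] [SecondCountableTopology H] [CompleteSpace H]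

/-- The cross term of two independent vectors, one of them centered, vanishes. -/
lemma integral_inner_eq_zero_of_indepFun {Ω : Type*} {mΩ : MeasurableSpace Ω} {P : Measure Ω}
    [IsProbabilityMeasure P] {X Y : Ω → H} (hXY : IndepFun X Y P)
    (hXm : AEMeasurable X P) (hYm : AEMeasurable Y P) (hX : Integrable X P) (hY : Integrable Y P)
    (hY0 : ∫ ω, Y ω ∂P = 0) :
    Integrable (fun ω => ⟪X ω, Y ω⟫) P ∧ ∫ ω, ⟪X ω, Y ω⟫ ∂P = 0 := by
  have hlaw := (indepFun_iff_map_prod_eq_prod_map_map hXm hYm).1 hXY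
  have : IsProbabilityMeasure (P.map X) := Measure.isProbabilityMeasure_map hXm
  have : IsProbabilityMeasure (P.map Y) := Measure.isProbabilityMeasure_map hYm
  have hXi : Integrable (fun x : H => x) (P.map X) := by
    rw [integrable_map_measure (by fun_prop) hXm]; exact hX
  have hYi : Integrable (fun x : H => x) (P.map Y) := by
    rw [integrable_map_measure (by fun_prop) hYm]; exact hY
  have hi : Integrable (fun z : H × H => ⟪z.1, z.2⟫) ((P.map X).prod (P.map Y)) := by
    refine (Integrable.mul_prod hXi.norm hYi.norm).mono' (by fun_prop) ?_
    exact ae_of_all _ fun z => norm_inner_le_norm z.1 z.2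
  have hpair : AEMeasurable (fun ω => (X ω, Y ω)) P := hXm.prodMk hYm
  constructor
  · have := hi
    rw [← hlaw, integrable_map_measure (by fun_prop) hpair] at this
    exact this
  · have h1 : ∫ ω, ⟪X ω, Y ω⟫ ∂P = ∫ z : H × H, ⟪z.1, z.2⟫ ∂(P.map fun ω => (X ω, Y ω)) :=
      (integral_map hpair (f := fun z : H × H => ⟪z.1, z.2⟫) (by fun_prop)).symm
    rw [h1, hlaw, integral_prod _ hi]
    have h2 : ∫ y, y ∂(P.map Y) = 0 := by
      rw [integral_map hYm (by fun_prop)]; exact hY0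
    have h3 : ∀ x : H, ∫ y, ⟪x, y⟫ ∂(P.map Y) = 0 := fun x => by
      rw [integral_inner hYi, h2, inner_zero_right]
    simp [h3]

/-- **Moment inequality.** The `2q`-th moment of a sum of `m` independent centered vectors of a
Hilbert space is at most `(16 q² m) ^ q` times a common bound of their own `2q`-th moments. -/
theorem integral_norm_sum_pow_le {Ω ι : Type*} {mΩ : MeasurableSpace Ω} {P : Measure Ω}
    [IsProbabilityMeasure P] {X : ι → Ω → H} (hind : iIndepFun X P)
    (hm : ∀ i, AEMeasurable (X i) P) (p : ℕ) {B : ℝ}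
    (hL : ∀ i, MemLp (X i) ((2 * (p + 1) : ℕ) : ENNReal) P)
    (h0 : ∀ i, ∫ ω, X i ω ∂P = 0) (hB : ∀ i, ∫ ω, ‖X i ω‖ ^ (2 * (p + 1)) ∂P ≤ B)
    (s : Finset ι) :
    ∫ ω, ‖∑ i ∈ s, X i ω‖ ^ (2 * (p + 1)) ∂P ≤ (16 * ((p : ℝ) + 1) ^ 2 * s.card) ^ (p + 1) * B := by
  classical
  induction s using Finset.induction_on with
  | empty => simp
  | insert i s his ih =>
    set S : Ω → H := fun ω => ∑ j ∈ s, X j ω with hS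
    have hSL : MemLp S ((2 * (p + 1) : ℕ) : ENNReal) P := memLp_finsetSum s fun j _ => hL j
    have hSm : AEMeasurable S P := Finset.aemeasurable_fun_sum s fun j _ => hm j
    have hB0 : 0 ≤ B := le_trans (integral_nonneg fun ω => by positivity) (hB i)
    have hindS : IndepFun S (X i) P := by
      have := hind.indepFun_finsetSum_of_notMem₀ hm his
      have e : S = ∑ j ∈ s, X j := by ext ω; simp [hS]
      rwa [e]
    have hq0 : (2 * (p + 1) : ℕ) ≠ 0 := by omega
    have iS : Integrable (fun ω => ‖S ω‖ ^ (2 * (p + 1))) P := hSL.integrable_norm_pow hq0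
    have iX : Integrable (fun ω => ‖X i ω‖ ^ (2 * (p + 1))) P := (hL i).integrable_norm_pow hq0
    have iSX : Integrable (fun ω => ‖S ω + X i ω‖ ^ (2 * (p + 1))) P :=
      (hSL.add (hL i)).integrable_norm_pow hq0
    have hXi : Integrable (X i) P := (hL i).integrable (by
      norm_cast; omega)
    -- the lower-order power of `S` in the cross term is integrable
    have iS' : Integrable (fun ω => ‖S ω‖ ^ (2 * p) • S ω) P := by
      refine ((integrable_const (1 : ℝ)).add iS).mono' ?_ (ae_of_all _ fun ω => ?_)
      · exact (((hSm.norm.pow_const _).smul hSm)).aestronglyMeasurable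
      · rw [norm_smul, norm_pow, norm_norm, ← pow_succ]
        simp only [Pi.add_apply]
        rcases le_total ‖S ω‖ 1 with h | h
        · have : ‖S ω‖ ^ (2 * p + 1) ≤ 1 := pow_le_one₀ (norm_nonneg _) h
          have : 0 ≤ ‖S ω‖ ^ (2 * (p + 1)) := by positivity
          linarith
        · have : ‖S ω‖ ^ (2 * p + 1) ≤ ‖S ω‖ ^ (2 * (p + 1)) := pow_le_pow_right₀ h (by omega)
          linarith
    have hind' : IndepFun (fun ω => ‖S ω‖ ^ (2 * p) • S ω) (X i) P :=
      hindS.comp (by fun_prop : Measurable fun x : H => ‖x‖ ^ (2 * p) • x) measurable_id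
    have hcross := integral_inner_eq_zero_of_indepFun hind'
      ((hSm.norm.pow_const _).smul hSm) (hm i) iS' hXi (h0 i)
    -- the scale of the squared norm of the enlarged sum; smaller scales are rounded up to it
    set T : ℝ := 16 * ((p : ℝ) + 1) ^ 2 * (s.card + 1) with hT
    have hcard : (0 : ℝ) ≤ s.card := Nat.cast_nonneg _
    have hTle : 16 * ((p : ℝ) + 1) ^ 2 ≤ T := by
      rw [hT]; exact le_mul_of_one_le_right (by positivity) (by linarith)
    have hT0 : 0 < T := lt_of_lt_of_le (by positivity) hTle
    have hpt : ∀ ω, ‖S ω + X i ω‖ ^ (2 * (p + 1)) ≤ ‖S ω‖ ^ (2 * (p + 1))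
        + 2 * (p + 1) * ⟪‖S ω‖ ^ (2 * p) • S ω, X i ω⟫
        + 2 * (p + 1) ^ 2 * (T ^ p * (3 * ‖X i ω‖ ^ (2 * (p + 1)))
          + 2 * ‖S ω‖ ^ (2 * (p + 1)) / T) := fun ω => by
      refine (norm_add_pow_le (S ω) (X i ω) p).trans ?_
      gcongr
      exact sq_mul_add_pow_le (norm_nonneg _) (norm_nonneg _) p hTle
    have hint : ∫ ω, ‖S ω + X i ω‖ ^ (2 * (p + 1)) ∂P ≤ ∫ ω, ‖S ω‖ ^ (2 * (p + 1)) ∂P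
        + 2 * (p + 1) ^ 2 * (T ^ p * (3 * ∫ ω, ‖X i ω‖ ^ (2 * (p + 1)) ∂P)
          + 2 * (∫ ω, ‖S ω‖ ^ (2 * (p + 1)) ∂P) / T) := by
      have i1 := hcross.1.const_mul (2 * ((p : ℝ) + 1))
      have i2 := ((iX.const_mul 3).const_mul (T ^ p))
      have i3 := ((iS.const_mul 2).div_const T)
      refine (integral_mono iSX ((iS.fun_add i1).fun_add
        ((i2.fun_add i3).const_mul (2 * ((p : ℝ) + 1) ^ 2))) hpt).trans (le_of_eq ?_)
      rw [integral_add (iS.fun_add i1) ((i2.fun_add i3).const_mul _), integral_add iS i1,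
        integral_const_mul, hcross.2, integral_const_mul, integral_add i2 i3, integral_const_mul,
        integral_const_mul, integral_div, integral_const_mul]
      ring
    have hsum : ∀ ω, ∑ j ∈ insert i s, X j ω = S ω + X i ω := fun ω => by
      rw [Finset.sum_insert his, add_comm]
    simp only [hsum]
    rw [Finset.card_insert_of_notMem his]
    push_cast
    rw [← hT]
    have hIS : ∫ ω, ‖S ω‖ ^ (2 * (p + 1)) ∂P ≤ (16 * ((p : ℝ) + 1) ^ 2 * s.card) * (T ^ p * B) := by
      refine ih.trans ?_
      rw [pow_succ', mul_assoc]
      gcongr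
      rw [hT]
      gcongr
      linarith
    have hIS' : (∫ ω, ‖S ω‖ ^ (2 * (p + 1)) ∂P) / T ≤ T ^ p * B := by
      rw [div_le_iff₀ hT0]
      refine hIS.trans ?_
      rw [mul_comm]
      gcongr
      rw [hT]
      gcongr
      linarith
    calc ∫ ω, ‖S ω + X i ω‖ ^ (2 * (p + 1)) ∂P
        ≤ (16 * ((p : ℝ) + 1) ^ 2 * s.card) * (T ^ p * B)
          + 2 * (p + 1) ^ 2 * (T ^ p * (3 * B) + 2 * (T ^ p * B)) := by
          refine hint.trans ?_
          rw [mul_div_assoc]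
          gcongr
          exact hB i
      _ ≤ T * (T ^ p * B) := by
          rw [hT]
          have : 0 ≤ T ^ p * B := by positivity
          have h6 : 0 ≤ ((p : ℝ) + 1) ^ 2 * (T ^ p * B) := by positivity
          rw [← hT]
          nlinarith
      _ = T ^ (p + 1) * B := by ring

end Moments

/-! ### A pointwise bound for the sum of squared Hermite polynomials -/

lemma derivative_hermite_succ (m : ℕ) : Polynomial.derivative (Polynomial.hermite (m + 1))
    = ((m : Polynomial ℤ) + 1) * Polynomial.hermite m := by
  induction m with
  | zero => simp
  | succ m ih =>
    rw [Polynomial.hermite_succ (m + 1), ih, Polynomial.derivative_sub, Polynomial.derivative_mul,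
      Polynomial.derivative_X, ih, Polynomial.derivative_mul]
    have h : Polynomial.derivative ((m : Polynomial ℤ) + 1) = 0 := by simp
    rw [h, Polynomial.hermite_succ m]
    push_cast
    ring

/-- Three-term recurrence of the normalized Hermite polynomials. -/
lemma hermiteOne_succ_succ (σ x : ℝ) (k : ℕ) :
    √((k : ℝ) + 2) * hermiteOne σ (k + 2) x
      = x / σ * hermiteOne σ (k + 1) x - √((k : ℝ) + 1) * hermiteOne σ k x := by
  have hrec : Polynomial.aeval (x / σ) (Polynomial.hermite (k + 2))
      = x / σ * Polynomial.aeval (x / σ) (Polynomial.hermite (k + 1))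
        - ((k : ℝ) + 1) * Polynomial.aeval (x / σ) (Polynomial.hermite k) := by
    rw [Polynomial.hermite_succ (k + 1), derivative_hermite_succ]
    simp
  unfold hermiteOne
  rw [hrec]
  have h1 : √((k + 1)! : ℝ) = √((k : ℝ) + 1) * √(k ! : ℝ) := by
    rw [← Real.sqrt_mul (by positivity), Nat.factorial_succ]
    push_cast
    rfl
  have h2 : √((k + 2)! : ℝ) = √((k : ℝ) + 2) * (√((k : ℝ) + 1) * √(k ! : ℝ)) := by
    rw [← h1, ← Real.sqrt_mul (by positivity), Nat.factorial_succ]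
    push_cast
    ring_nf
  rw [h1, h2]
  have p0 : 0 < √(k ! : ℝ) := Real.sqrt_pos.2 (by positivity)
  have p1 : 0 < √((k : ℝ) + 1) := Real.sqrt_pos.2 (by positivity)
  have p2 : 0 < √((k : ℝ) + 2) := Real.sqrt_pos.2 (by positivity)
  have s1 : √((k : ℝ) + 1) ^ 2 = (k : ℝ) + 1 := Real.sq_sqrt (by positivity)
  generalize √((k : ℝ) + 1) = w at *
  rw [← s1]
  field_simp

lemma mul_sum_pow_div_factorial_le {u : ℝ} (hu : 0 ≤ u) (k : ℕ) :
    u * ∑ j ∈ Finset.range (k + 1), u ^ j / (j ! : ℝ)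
      ≤ (k + 1) * ∑ j ∈ Finset.range (k + 2), u ^ j / (j ! : ℝ) := by
  rw [Finset.sum_range_succ' _ (k + 1), mul_add, Finset.mul_sum, Finset.mul_sum]
  refine le_add_of_le_of_nonneg (Finset.sum_le_sum fun j hj => ?_) (by positivity)
  have hj' : (j : ℝ) ≤ k := by
    have := Finset.mem_range_succ_iff.1 hj
    exact_mod_cast this
  rw [Nat.factorial_succ]
  push_cast
  have hf : (0 : ℝ) < (j ! : ℝ) := by positivity
  calc u * (u ^ j / (j ! : ℝ)) = u ^ (j + 1) / (j ! : ℝ) := by ring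
    _ = (j + 1) * (u ^ (j + 1) / ((j + 1) * (j ! : ℝ))) := by field_simp
    _ ≤ (k + 1) * (u ^ (j + 1) / ((j + 1) * (j ! : ℝ))) := by gcongr

/-- Growth of the Hermite polynomials: by the three-term recurrence, `h_k(x)²` is at most `3 ^ k`
times the `k`-th Taylor polynomial of the exponential at `(x / σ)²`. -/
lemma hermiteOne_sq_le (σ x : ℝ) (k : ℕ) :
    hermiteOne σ k x ^ 2 ≤ 3 ^ k * ∑ j ∈ Finset.range (k + 1), ((x / σ) ^ 2) ^ j / (j ! : ℝ) := by
  induction k using Nat.twoStepInduction with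
  | zero => simp [hermiteOne]
  | one =>
    simp [hermiteOne, Finset.sum_range_succ]
    nlinarith [sq_nonneg (x / σ)]
  | more k ih1 ih2 =>
    set u := (x / σ) ^ 2 with hu
    have hu0 : 0 ≤ u := sq_nonneg _
    set E : ℕ → ℝ := fun m => ∑ j ∈ Finset.range (m + 1), u ^ j / (j ! : ℝ) with hE
    change hermiteOne σ k x ^ 2 ≤ 3 ^ k * E k at ih1
    change hermiteOne σ (k + 1) x ^ 2 ≤ 3 ^ (k + 1) * E (k + 1) at ih2
    change hermiteOne σ (k + 2) x ^ 2 ≤ 3 ^ (k + 2) * E (k + 2)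
    have hrec := hermiteOne_succ_succ σ x k
    have hmul : u * E (k + 1) ≤ (k + 2) * E (k + 2) := by
      have := mul_sum_pow_div_factorial_le hu0 (k + 1)
      push_cast at this
      calc u * E (k + 1) ≤ ((k : ℝ) + 1 + 1) * E (k + 2) := this
        _ = _ := by ring
    have hmono : E k ≤ E (k + 2) :=
      Finset.sum_le_sum_of_subset_of_nonneg (Finset.range_mono (by omega))
        fun j _ _ => by positivity
    have hE0 : 0 ≤ E (k + 2) := Finset.sum_nonneg fun j _ => by positivity
    have hk : (0 : ℝ) ≤ k := Nat.cast_nonneg k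
    have s1 : √((k : ℝ) + 1) ^ 2 = (k : ℝ) + 1 := Real.sq_sqrt (by positivity)
    have s2 : √((k : ℝ) + 2) ^ 2 = (k : ℝ) + 2 := Real.sq_sqrt (by positivity)
    have key : ((k : ℝ) + 2) * hermiteOne σ (k + 2) x ^ 2
        ≤ 2 * (u * hermiteOne σ (k + 1) x ^ 2) + 2 * ((k + 1) * hermiteOne σ k x ^ 2) := by
      have e : ((k : ℝ) + 2) * hermiteOne σ (k + 2) x ^ 2
          = (x / σ * hermiteOne σ (k + 1) x - √((k : ℝ) + 1) * hermiteOne σ k x) ^ 2 := by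
        rw [← hrec, mul_pow, s2]
      rw [e, hu]
      generalize √((k : ℝ) + 1) = w at *
      rw [← s1]
      nlinarith [sq_nonneg (x / σ * hermiteOne σ (k + 1) x + w * hermiteOne σ k x)]
    have b1 : u * hermiteOne σ (k + 1) x ^ 2 ≤ 3 ^ (k + 1) * ((k + 2) * E (k + 2)) := by
      calc u * hermiteOne σ (k + 1) x ^ 2 ≤ u * (3 ^ (k + 1) * E (k + 1)) := by gcongr
        _ = 3 ^ (k + 1) * (u * E (k + 1)) := by ring
        _ ≤ _ := by gcongr
    have b2 : ((k : ℝ) + 1) * hermiteOne σ k x ^ 2 ≤ (k + 2) * (3 ^ k * E (k + 2)) := by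
      have : hermiteOne σ k x ^ 2 ≤ 3 ^ k * E (k + 2) := ih1.trans (by gcongr)
      gcongr
      norm_num
    have hfin : ((k : ℝ) + 2) * hermiteOne σ (k + 2) x ^ 2
        ≤ (k + 2) * (3 ^ (k + 2) * E (k + 2)) := by
      refine key.trans ?_
      have h3 : 0 ≤ ((k : ℝ) + 2) * (3 ^ k * E (k + 2)) := by positivity
      calc 2 * (u * hermiteOne σ (k + 1) x ^ 2) + 2 * ((k + 1) * hermiteOne σ k x ^ 2)
          ≤ 2 * (3 ^ (k + 1) * ((k + 2) * E (k + 2))) + 2 * ((k + 2) * (3 ^ k * E (k + 2))) := by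
            gcongr
        _ = 8 * ((k + 2) * (3 ^ k * E (k + 2))) := by ring
        _ ≤ 9 * ((k + 2) * (3 ^ k * E (k + 2))) := by gcongr; norm_num
        _ = _ := by ring
    exact le_of_mul_le_mul_left hfin (by positivity)

lemma sum_pow_mul_sum_le {t u : ℝ} (ht : 0 ≤ t) (ht' : t ≤ 1 / 2) (hu : 0 ≤ u) (d : ℕ) :
    ∑ k ∈ Finset.range (d + 1), t ^ k * ∑ j ∈ Finset.range (k + 1), u ^ j / (j ! : ℝ)
      ≤ Real.exp (t * u + 2 * t) := by
  -- the double sum is dominated by the product of an exponential and a geometric series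
  have h1 : ∑ k ∈ Finset.range (d + 1), t ^ k * ∑ j ∈ Finset.range (k + 1), u ^ j / (j ! : ℝ)
      ≤ (∑ j ∈ Finset.range (d + 1), (t * u) ^ j / (j ! : ℝ)) * ∑ i ∈ Finset.range (d + 1), t ^ i := by
    have e1 : ∀ k ∈ Finset.range (d + 1),
        t ^ k * ∑ j ∈ Finset.range (k + 1), u ^ j / (j ! : ℝ)
        = ∑ j ∈ Finset.range (d + 1), if j ≤ k then t ^ k * (u ^ j / (j ! : ℝ)) else 0 := by
      intro k hk
      rw [Finset.mul_sum, ← Finset.sum_filter]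
      refine Finset.sum_congr ?_ fun _ _ => rfl
      ext j
      simp only [Finset.mem_range, Finset.mem_filter] at hk ⊢
      omega
    rw [Finset.sum_congr rfl e1, Finset.sum_comm, Finset.sum_mul]
    refine Finset.sum_le_sum fun j _ => ?_
    rw [← Finset.sum_filter, Finset.mul_sum]
    have hmaps : ∀ k ∈ (Finset.range (d + 1)).filter (fun k => j ≤ k),
        k - j ∈ Finset.range (d + 1) := by
      intro k hk
      simp only [Finset.mem_range, Finset.mem_filter] at hk ⊢
      omega
    have hinj : Set.InjOn (fun k => k - j) ((Finset.range (d + 1)).filter (fun k => j ≤ k)) := by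
      intro a ha b hb hab
      simp only [Finset.coe_filter, Finset.mem_range, Set.mem_ofPred_eq] at ha hb hab
      omega
    calc ∑ k ∈ (Finset.range (d + 1)).filter (fun k => j ≤ k), t ^ k * (u ^ j / (j ! : ℝ))
        = ∑ k ∈ (Finset.range (d + 1)).filter (fun k => j ≤ k),
            (t * u) ^ j / (j ! : ℝ) * t ^ (k - j) := by
          refine Finset.sum_congr rfl fun k hk => ?_
          have hjk := (Finset.mem_filter.1 hk).2
          rw [← pow_sub_mul_pow t hjk, mul_pow]
          ring
      _ = ∑ i ∈ ((Finset.range (d + 1)).filter (fun k => j ≤ k)).image (fun k => k - j),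
            (t * u) ^ j / (j ! : ℝ) * t ^ i :=
          (Finset.sum_image (f := fun i => (t * u) ^ j / (j ! : ℝ) * t ^ i) hinj).symm
      _ ≤ _ := Finset.sum_le_sum_of_subset_of_nonneg (Finset.image_subset_iff.2 hmaps)
            fun i _ _ => by positivity
  have h2 : ∑ i ∈ Finset.range (d + 1), t ^ i ≤ 1 + 2 * t := by
    have hg := geom_sum_mul_neg t (d + 1)
    have : 0 ≤ t ^ (d + 1) := by positivity
    have hs : (∑ i ∈ Finset.range (d + 1), t ^ i) * (1 - t) ≤ 1 := by linarith
    by_contra! hcon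
    nlinarith [mul_lt_mul_of_pos_right hcon (by linarith : 0 < 1 - t)]
  calc _ ≤ _ := h1
    _ ≤ Real.exp (t * u) * Real.exp (2 * t) := by
      gcongr
      · exact Real.sum_le_exp_of_nonneg (by positivity) _
      · exact h2.trans (by rw [add_comm]; exact Real.add_one_le_exp _)
    _ = _ := (Real.exp_add _ _).symm

/-- The sum `∑ₖ h_k(z)²`, `|k| ≤ d`: the squared norm of the feature vector of all Hermite
polynomials of degree at most `d`. -/
noncomputable def hermiteEnergy (n d : ℕ) (σ : ℝ) (z : Vec n) : ℝ :=
  ∑ k : MultiIdx n d, hermiteMulti σ k z ^ 2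

/-- Weighting the degree by `r ^ |k|` factorizes the sum over multi-indices; this plays the role of
Mehler's formula. -/
lemma hermiteEnergy_le {n d : ℕ} {σ r : ℝ} (hr : 0 < r) (hr' : 3 * r ≤ 1 / 2) (z : Vec n) :
    hermiteEnergy n d σ z
      ≤ (r ^ d)⁻¹ * Real.exp (3 * r * (‖z‖ ^ 2 / σ ^ 2 + 2 * n)) := by
  have hr1 : r ≤ 1 := by linarith
  have h1 : hermiteEnergy n d σ z
      ≤ (r ^ d)⁻¹ * ∑ k : MultiIdx n d, ∏ i, (r ^ (k.1 i : ℕ) * hermiteOne σ (k.1 i : ℕ) (z i) ^ 2) := by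
    unfold hermiteEnergy
    rw [Finset.mul_sum]
    refine Finset.sum_le_sum fun k _ => ?_
    rw [Finset.prod_mul_distrib, Finset.prod_pow_eq_pow_sum, Finset.prod_pow, ← mul_assoc]
    change hermiteMulti σ k z ^ 2 ≤ _ * hermiteMulti σ k z ^ 2
    refine le_mul_of_one_le_left (sq_nonneg _) ?_
    rw [inv_mul_eq_div, one_le_div (by positivity)]
    exact pow_le_pow_of_le_one hr.le hr1 k.2
  have h2 : ∑ k : MultiIdx n d, ∏ i, (r ^ (k.1 i : ℕ) * hermiteOne σ (k.1 i : ℕ) (z i) ^ 2)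
      ≤ ∏ i : Fin n, ∑ k : Fin (d + 1), (r ^ (k : ℕ) * hermiteOne σ (k : ℕ) (z i) ^ 2) := by
    rw [Fintype.prod_sum]
    refine le_trans (le_of_eq (Finset.sum_map Finset.univ (Function.Embedding.subtype _)
      (fun k : Fin n → Fin (d + 1) =>
        ∏ i, (r ^ (k i : ℕ) * hermiteOne σ (k i : ℕ) (z i) ^ 2))).symm) ?_
    exact Finset.sum_le_sum_of_subset_of_nonneg (Finset.subset_univ _)
      fun k _ _ => Finset.prod_nonneg fun i _ => by positivity
  have h3 : ∀ i, ∑ k : Fin (d + 1), (r ^ (k : ℕ) * hermiteOne σ (k : ℕ) (z i) ^ 2)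
      ≤ Real.exp (3 * r * (z i / σ) ^ 2 + 2 * (3 * r)) := fun i => by
    rw [Fin.sum_univ_eq_sum_range (fun k => r ^ k * hermiteOne σ k (z i) ^ 2) (d + 1)]
    refine le_trans (Finset.sum_le_sum fun k _ => ?_)
      (sum_pow_mul_sum_le (by positivity) hr' (sq_nonneg (z i / σ)) d)
    rw [mul_pow, mul_comm (3 ^ k), mul_assoc]
    gcongr
    exact hermiteOne_sq_le σ (z i) k
  calc _ ≤ _ := h1
    _ ≤ (r ^ d)⁻¹ * ∏ i : Fin n, Real.exp (3 * r * (z i / σ) ^ 2 + 2 * (3 * r)) := by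
      gcongr
      exact h2.trans (Finset.prod_le_prod (fun i _ => Finset.sum_nonneg fun k _ => by positivity)
        fun i _ => h3 i)
    _ = _ := by
      rw [← Real.exp_sum, Finset.sum_add_distrib, EuclideanSpace.real_norm_sq_eq]
      congr 2
      simp only [Finset.sum_const, Finset.card_univ, Fintype.card_fin, nsmul_eq_mul, div_pow,
        ← Finset.mul_sum, ← Finset.sum_div]
      ring

lemma one_le_hermiteEnergy (n d : ℕ) (σ : ℝ) (z : Vec n) : 1 ≤ hermiteEnergy n d σ z := by
  let k0 : MultiIdx n d := ⟨fun _ => 0, by simp⟩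
  have h : hermiteMulti σ k0 z ^ 2 = 1 := by simp [hermiteMulti, hermiteOne, k0]
  rw [← h]
  exact Finset.single_le_sum (f := fun k : MultiIdx n d => hermiteMulti σ k z ^ 2)
    (fun k _ => sq_nonneg _) (Finset.mem_univ k0)

lemma continuous_hermiteMulti {n d : ℕ} (σ : ℝ) (k : MultiIdx n d) :
    Continuous (fun z : Vec n => hermiteMulti σ k z) := by
  unfold hermiteMulti hermiteOne
  fun_prop

lemma continuous_hermiteEnergy (n d : ℕ) (σ : ℝ) : Continuous (hermiteEnergy n d σ) :=
  continuous_finsetSum _ fun k _ => (continuous_hermiteMulti σ k).pow 2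

lemma continuous_hermiteSum {n d : ℕ} (σ : ℝ) (b : Coeffs n d) : Continuous (hermiteSum σ b) :=
  continuous_finsetSum _ fun k _ => (continuous_hermiteMulti σ k).smul continuous_const

lemma norm_hermiteSum_sq_le {n d : ℕ} (σ : ℝ) (b : Coeffs n d) (z : Vec n) :
    ‖hermiteSum σ b z‖ ^ 2 ≤ ‖b‖ ^ 2 * hermiteEnergy n d σ z := by
  have h1 : ‖hermiteSum σ b z‖ ≤ ∑ k, |hermiteMulti σ k z| * ‖b k‖ := by
    refine (norm_sum_le _ _).trans (le_of_eq ?_)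
    simp [norm_smul]
  have h2 := Finset.sum_mul_sq_le_sq_mul_sq Finset.univ
    (fun k : MultiIdx n d => |hermiteMulti σ k z|) (fun k => ‖b k‖)
  calc ‖hermiteSum σ b z‖ ^ 2 ≤ (∑ k, |hermiteMulti σ k z| * ‖b k‖) ^ 2 := by gcongr
    _ ≤ _ := h2
    _ = ‖b‖ ^ 2 * hermiteEnergy n d σ z := by
      rw [PiLp.norm_sq_eq_of_L2, mul_comm]
      simp [hermiteEnergy, sq_abs]

/-! ### The Gaussian noise and the law of a signal with its noisy observation -/

/-- Density of `𝒩(0, σ² Iₙ)` with respect to Lebesgue measure. -/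
noncomputable def noiseDensity (n : ℕ) (σ : ℝ) (x : Vec n) : ℝ :=
  ((2 * Real.pi * σ ^ 2) ^ ((n : ℝ) / 2))⁻¹ * Real.exp (-(1 / (2 * σ ^ 2)) * ‖x‖ ^ 2)

lemma noiseDensity_pos {n : ℕ} {σ : ℝ} (hσ : 0 < σ) (x : Vec n) : 0 < noiseDensity n σ x := by
  have := Real.pi_pos
  unfold noiseDensity
  positivity

lemma continuous_noiseDensity (n : ℕ) (σ : ℝ) : Continuous (noiseDensity n σ) := by
  unfold noiseDensity
  fun_prop

lemma integrable_exp_neg_mul_sq_norm {n : ℕ} {b : ℝ} (hb : 0 < b) :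
    Integrable (fun x : Vec n => Real.exp (-b * ‖x‖ ^ 2)) := by
  refine Integrable.of_integral_ne_zero ?_
  rw [GaussianFourier.integral_rexp_neg_mul_sq_norm hb]
  have := Real.pi_pos
  positivity

lemma integrable_noiseDensity {n : ℕ} {σ : ℝ} (hσ : 0 < σ) : Integrable (noiseDensity n σ) :=
  (integrable_exp_neg_mul_sq_norm (by positivity)).const_mul _

instance isProbabilityMeasure_noiseLaw (n : ℕ) (σ : ℝ) : IsProbabilityMeasure (noiseLaw n σ) :=
  Measure.isProbabilityMeasure_map (by fun_prop)

/-- The two measures have the same characteristic function. -/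
lemma noiseLaw_eq_withDensity (n : ℕ) {σ : ℝ} (hσ : 0 < σ) :
    noiseLaw n σ = volume.withDensity (fun x => ENNReal.ofReal (noiseDensity n σ x)) := by
  have hfin : IsFiniteMeasure (volume.withDensity
      (fun x : Vec n => ENNReal.ofReal (noiseDensity n σ x))) :=
    isFiniteMeasure_withDensity_ofReal (integrable_noiseDensity hσ).2
  have hpi := Real.pi_pos
  apply Measure.ext_of_charFun
  ext t
  have h1 : charFun (noiseLaw n σ) t = Complex.exp (-(σ ^ 2 * ‖t‖ ^ 2) / 2) := by
    rw [noiseLaw, charFun_map_smul, charFun_stdGaussian, norm_smul]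
    congr 1
    push_cast
    rw [mul_pow, ← Complex.ofReal_pow, Real.norm_eq_abs, sq_abs]
    push_cast
    ring
  rw [h1, charFun_apply, integral_withDensity_eq_integral_toReal_smul
    (by exact (continuous_noiseDensity n σ).measurable.ennreal_ofReal) (by simp)]
  have hb : 0 < ((1 / (2 * σ ^ 2) : ℝ) : ℂ).re := by
    rw [Complex.ofReal_re]; positivity
  have h2 : ∀ x : Vec n, (ENNReal.ofReal (noiseDensity n σ x)).toReal •
      Complex.exp (⟪x, t⟫ * Complex.I)
      = (((2 * Real.pi * σ ^ 2) ^ ((n : ℝ) / 2))⁻¹ : ℝ) *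
        Complex.exp (-((1 / (2 * σ ^ 2) : ℝ) : ℂ) * ‖x‖ ^ 2 + Complex.I * ⟪t, x⟫) := fun x => by
    rw [ENNReal.toReal_ofReal (noiseDensity_pos hσ x).le, noiseDensity, Complex.exp_add,
      real_inner_comm, Complex.real_smul]
    push_cast
    rw [mul_comm Complex.I]
    ring
  simp_rw [h2]
  rw [integral_const_mul, GaussianFourier.integral_cexp_neg_mul_sq_norm_add hb]
  have h3 : (Real.pi / ((1 / (2 * σ ^ 2) : ℝ) : ℂ)) ^ ((Module.finrank ℝ (Vec n) : ℂ) / 2)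
      = (((2 * Real.pi * σ ^ 2) ^ ((n : ℝ) / 2) : ℝ) : ℂ) := by
    rw [Complex.ofReal_cpow (by positivity)]
    congr 1
    · push_cast
      have : (σ : ℂ) ≠ 0 := by exact_mod_cast hσ.ne'
      field_simp
    · simp
  rw [h3, ← mul_assoc, ← Complex.ofReal_mul, inv_mul_cancel₀ (by positivity)]
  rw [Complex.ofReal_one, one_mul]
  congr 1
  have : (σ : ℂ) ≠ 0 := by exact_mod_cast hσ.ne'
  push_cast
  rw [Complex.I_sq]
  field_simp
  ring

/-- Exponential moments of the squared norm of the noise. -/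
lemma integral_exp_sq_norm_noiseLaw_le {n : ℕ} {σ l : ℝ} (hσ : 0 < σ) (hl0 : 0 ≤ l)
    (hl : l ≤ 1 / 4) :
    Integrable (fun x : Vec n => Real.exp (l * (‖x‖ ^ 2 / σ ^ 2))) (noiseLaw n σ) ∧
      ∫ x, Real.exp (l * (‖x‖ ^ 2 / σ ^ 2)) ∂(noiseLaw n σ) ≤ Real.exp (2 * l * n) := by
  have hpi := Real.pi_pos
  have hb : 0 < (1 / 2 - l) / σ ^ 2 := by
    have : 0 < 1 / 2 - l := by linarith
    positivity
  have hmeas : Measurable (fun x : Vec n => ENNReal.ofReal (noiseDensity n σ x)) :=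
    (continuous_noiseDensity n σ).measurable.ennreal_ofReal
  have h2 : ∀ x : Vec n, (ENNReal.ofReal (noiseDensity n σ x)).toReal •
      Real.exp (l * (‖x‖ ^ 2 / σ ^ 2))
      = ((2 * Real.pi * σ ^ 2) ^ ((n : ℝ) / 2))⁻¹ *
        Real.exp (-((1 / 2 - l) / σ ^ 2) * ‖x‖ ^ 2) := fun x => by
    rw [ENNReal.toReal_ofReal (noiseDensity_pos hσ x).le, noiseDensity, smul_eq_mul, mul_assoc,
      ← Real.exp_add]
    congr 2
    field_simp
    ring
  rw [noiseLaw_eq_withDensity n hσ]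
  constructor
  · rw [integrable_withDensity_iff_integrable_smul' hmeas (by simp)]
    simp_rw [h2]
    exact (integrable_exp_neg_mul_sq_norm hb).const_mul _
  · rw [integral_withDensity_eq_integral_toReal_smul hmeas (by simp)]
    simp_rw [h2]
    rw [integral_const_mul, GaussianFourier.integral_rexp_neg_mul_sq_norm hb,
      finrank_euclideanSpace_fin, ← div_eq_inv_mul, ← Real.div_rpow (by positivity) (by positivity)]
    have h3 : Real.pi / ((1 / 2 - l) / σ ^ 2) / (2 * Real.pi * σ ^ 2) = 1 / (1 - 2 * l) := by
      have : 1 - 2 * l ≠ 0 := by linarith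
      have : 1 / 2 - l ≠ 0 := by linarith
      field_simp
    have h4 : 1 / (1 - 2 * l) ≤ Real.exp (4 * l) := by
      have h5 : 1 / (1 - 2 * l) ≤ 4 * l + 1 := by
        rw [div_le_iff₀ (by linarith)]
        nlinarith
      exact h5.trans (Real.add_one_le_exp _)
    rw [h3]
    calc (1 / (1 - 2 * l)) ^ ((n : ℝ) / 2) ≤ Real.exp (4 * l) ^ ((n : ℝ) / 2) := by
          refine Real.rpow_le_rpow ?_ h4 (by positivity)
          have : 0 < 1 - 2 * l := by linarith
          positivity
      _ = Real.exp (2 * l * n) := by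
          rw [← Real.exp_mul]
          congr 1
          ring

section Joint

variable {n : ℕ} {Q₀ : Measure (Vec n)} {σ D : ℝ}

lemma map_snd_denoisingLaw : (denoisingLaw Q₀ σ).map Prod.snd = mixtureLaw Q₀ σ := by
  rw [denoisingLaw, Measure.map_map measurable_snd (by fun_prop)]
  rfl

lemma ae_denoisingLaw_of_ae {p : Vec n → Prop} (hp : ∀ᵐ m ∂Q₀, p m) :
    ∀ᵐ z ∂(denoisingLaw Q₀ σ), p z.1 := by
  have h1 : (denoisingLaw Q₀ σ).map Prod.fst = Q₀ := by
    rw [denoisingLaw, Measure.map_map measurable_fst (by fun_prop)]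
    exact Measure.map_fst_prod.trans (by simp)
  rw [← h1] at hp
  exact ae_of_ae_map measurable_fst.aemeasurable hp

/-- The joint law of signal and observation has density `noiseDensity (y - μ)` with
respect to `Q₀ ⊗ dy`. -/
lemma denoisingLaw_eq_withDensity (hσ : 0 < σ) :
    denoisingLaw Q₀ σ = (Q₀.prod volume).withDensity
      (fun p => ENNReal.ofReal (noiseDensity n σ (p.2 - p.1))) := by
  have hmeas : Measurable (fun x : Vec n => ENNReal.ofReal (noiseDensity n σ x)) :=
    (continuous_noiseDensity n σ).measurable.ennreal_ofReal
  ext s hs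
  have hind : Measurable (s.indicator (fun _ => (1 : ENNReal))) := measurable_const.indicator hs
  have hsf : SFinite ((volume : Measure (Vec n)).withDensity
      (fun x => ENNReal.ofReal (noiseDensity n σ x))) := by
    rw [← noiseLaw_eq_withDensity n hσ]; infer_instance
  rw [withDensity_apply _ hs, ← lintegral_indicator hs, ← lintegral_indicator_one hs, denoisingLaw,
    lintegral_map (by exact hind) (by fun_prop), noiseLaw_eq_withDensity n hσ, lintegral_prod _
      (by exact (hind.comp (by fun_prop)).aemeasurable), lintegral_prod _
      (by exact ((hmeas.comp (by fun_prop)).indicator hs).aemeasurable)]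
  refine lintegral_congr fun m => ?_
  rw [lintegral_withDensity_eq_lintegral_mul _ hmeas (by exact hind.comp (by fun_prop))]
  refine Eq.trans (lintegral_congr fun x => ?_) (lintegral_add_left_eq_self (fun y =>
    s.indicator (fun p => ENNReal.ofReal (noiseDensity n σ (p.2 - p.1))) (m, y)) m)
  by_cases h : (m, m + x) ∈ s <;> simp [h]

lemma mixtureLaw_absolutelyContinuous (hσ : 0 < σ) : mixtureLaw Q₀ σ ≪ volume := by
  intro s hs
  obtain ⟨t, hst, ht, h0⟩ := exists_measurable_superset_of_null hs
  refine measure_mono_null hst ?_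
  rw [← map_snd_denoisingLaw, Measure.map_apply measurable_snd ht, denoisingLaw_eq_withDensity hσ]
  refine withDensity_absolutelyContinuous _ _ ?_
  have : (Prod.snd ⁻¹' t : Set (Vec n × Vec n)) = Set.univ ×ˢ t := by ext; simp
  rw [this, Measure.prod_prod, h0, mul_zero]

variable [IsProbabilityMeasure Q₀]

instance isProbabilityMeasure_denoisingLaw : IsProbabilityMeasure (denoisingLaw Q₀ σ) :=
  Measure.isProbabilityMeasure_map (by fun_prop)

instance isProbabilityMeasure_mixtureLaw : IsProbabilityMeasure (mixtureLaw Q₀ σ) := by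
  rw [← map_snd_denoisingLaw]
  exact Measure.isProbabilityMeasure_map (by fun_prop)

lemma ae_norm_le (hD : Q₀ (Metric.closedBall 0 D) = 1) : ∀ᵐ m ∂Q₀, ‖m‖ ≤ D := by
  have h := (prob_compl_eq_zero_iff (μ := Q₀) Metric.isClosed_closedBall.measurableSet).2 hD
  rw [ae_iff]
  convert h using 2
  ext m
  simp

/-! ### The posterior mean -/

lemma continuous_posteriorWeight (y : Vec n) : Continuous (posteriorWeight σ y) := by
  unfold posteriorWeight
  fun_prop

lemma integrable_posteriorWeight (hD : Q₀ (Metric.closedBall 0 D) = 1) (y : Vec n) :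
    Integrable (posteriorWeight σ y) Q₀ := by
  refine (integrable_const (Real.exp (‖y‖ * D / σ ^ 2))).mono'
    (continuous_posteriorWeight y).aestronglyMeasurable ?_
  filter_upwards [ae_norm_le hD] with m hm
  rw [posteriorWeight, Real.norm_eq_abs, Real.abs_exp]
  gcongr
  have h1 : ⟪y, m⟫ / σ ^ 2 ≤ ‖y‖ * D / σ ^ 2 := by
    gcongr
    exact (real_inner_le_norm y m).trans (by gcongr)
  have h2 : 0 ≤ ‖m‖ ^ 2 / (2 * σ ^ 2) := by positivity
  linarith

lemma integrable_posteriorWeight_smul (hD : Q₀ (Metric.closedBall 0 D) = 1) (y : Vec n) :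
    Integrable (fun m => posteriorWeight σ y m • m) Q₀ := by
  refine ((integrable_posteriorWeight (σ := σ) hD y).mul_const D).mono'
    ((continuous_posteriorWeight y).smul continuous_id).aestronglyMeasurable ?_
  filter_upwards [ae_norm_le hD] with m hm
  have h0 : 0 < posteriorWeight σ y m := Real.exp_pos _
  rw [norm_smul, Real.norm_of_nonneg h0.le]
  gcongr

lemma integral_posteriorWeight_pos (hD : Q₀ (Metric.closedBall 0 D) = 1) (y : Vec n) :
    0 < ∫ m, posteriorWeight σ y m ∂Q₀ :=
  integral_exp_pos (integrable_posteriorWeight hD y)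

lemma norm_posteriorMean_le (hD : Q₀ (Metric.closedBall 0 D) = 1) (y : Vec n) :
    ‖posteriorMean Q₀ σ y‖ ≤ D := by
  have hZ := integral_posteriorWeight_pos (σ := σ) hD y
  rw [posteriorMean, norm_smul, norm_inv, Real.norm_of_nonneg hZ.le, inv_mul_le_iff₀ hZ,
    ← integral_mul_const]
  refine norm_integral_le_of_norm_le ((integrable_posteriorWeight hD y).mul_const D) ?_
  filter_upwards [ae_norm_le hD] with m hm
  have h0 : 0 < posteriorWeight σ y m := Real.exp_pos _
  rw [norm_smul, Real.norm_of_nonneg h0.le]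
  gcongr

lemma measurable_posteriorMean : Measurable (posteriorMean Q₀ σ) := by
  have hw : Continuous (fun p : Vec n × Vec n => posteriorWeight σ p.1 p.2) := by
    unfold posteriorWeight
    fun_prop
  have h1 : StronglyMeasurable (fun y : Vec n => ∫ m, posteriorWeight σ y m ∂Q₀) :=
    hw.stronglyMeasurable.integral_prod_right'
  have h2 : StronglyMeasurable (fun y : Vec n => ∫ m, posteriorWeight σ y m • m ∂Q₀) :=
    (hw.smul continuous_snd).stronglyMeasurable.integral_prod_right'
  exact (h1.measurable.inv).smul h2.measurable

/-- The translated noise density is the posterior weight, up to a factor depending on the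
observation only. -/
lemma noiseDensity_sub (hσ : 0 < σ) (y m : Vec n) :
    noiseDensity n σ (y - m) = noiseDensity n σ y * posteriorWeight σ y m := by
  rw [noiseDensity, noiseDensity, posteriorWeight, mul_assoc _ (Real.exp _) (Real.exp _),
    ← Real.exp_add, norm_sub_sq_real, real_inner_comm]
  congr 2
  field_simp
  ring

/-- The posterior mean is the conditional expectation of the signal: the residual `μ - f(Y)` is
orthogonal to all functions of `Y`. -/
theorem integral_inner_sub_posteriorMean (hσ : 0 < σ) (hD : Q₀ (Metric.closedBall 0 D) = 1)
    {g : Vec n → Vec n} (hg : Measurable g)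
    (hgi : Integrable (fun p => g p.2) (denoisingLaw Q₀ σ)) :
    Integrable (fun p => ⟪g p.2, p.1 - posteriorMean Q₀ σ p.2⟫) (denoisingLaw Q₀ σ) ∧
      ∫ p, ⟪g p.2, p.1 - posteriorMean Q₀ σ p.2⟫ ∂(denoisingLaw Q₀ σ) = 0 := by
  have hf : Measurable (posteriorMean Q₀ σ) := measurable_posteriorMean
  have hF : Measurable (fun p : Vec n × Vec n => ⟪g p.2, p.1 - posteriorMean Q₀ σ p.2⟫) :=
    (hg.comp measurable_snd).inner (measurable_fst.sub (hf.comp measurable_snd))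
  have hint : Integrable (fun p => ⟪g p.2, p.1 - posteriorMean Q₀ σ p.2⟫)
      (denoisingLaw Q₀ σ) := by
    refine (hgi.norm.mul_const (D + D)).mono' hF.aestronglyMeasurable ?_
    filter_upwards [ae_denoisingLaw_of_ae (ae_norm_le hD)] with p hp
    refine (norm_inner_le_norm _ _).trans ?_
    gcongr
    exact (norm_sub_le _ _).trans (add_le_add hp (norm_posteriorMean_le hD _))
  refine ⟨hint, ?_⟩
  have hmeas : Measurable (fun p : Vec n × Vec n =>
      ENNReal.ofReal (noiseDensity n σ (p.2 - p.1))) :=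
    ((continuous_noiseDensity n σ).measurable.comp (by fun_prop)).ennreal_ofReal
  rw [denoisingLaw_eq_withDensity hσ] at hint ⊢
  rw [integrable_withDensity_iff_integrable_smul' hmeas (by simp)] at hint
  rw [integral_withDensity_eq_integral_toReal_smul hmeas (by simp), integral_prod_symm _ hint]
  -- after exchanging the integrals, Bayes' formula makes the integral over the signal vanish
  have hz : ∀ y : Vec n, ∫ m, (ENNReal.ofReal (noiseDensity n σ (y - m))).toReal •
      ⟪g y, m - posteriorMean Q₀ σ y⟫ ∂Q₀ = 0 := fun y => by
    have hZ := integral_posteriorWeight_pos (σ := σ) hD y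
    have i1 := integrable_posteriorWeight (σ := σ) hD y
    have i2 := integrable_posteriorWeight_smul (σ := σ) hD y
    have e : ∀ m, (ENNReal.ofReal (noiseDensity n σ (y - m))).toReal •
        ⟪g y, m - posteriorMean Q₀ σ y⟫
        = noiseDensity n σ y * ⟪g y, posteriorWeight σ y m • m -
          posteriorWeight σ y m • posteriorMean Q₀ σ y⟫ := fun m => by
      rw [ENNReal.toReal_ofReal (noiseDensity_pos hσ _).le, noiseDensity_sub hσ, ← smul_sub,
        inner_smul_right, smul_eq_mul, mul_assoc]
    simp_rw [e]
    have i3 : Integrable (fun m => posteriorWeight σ y m • m -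
        posteriorWeight σ y m • posteriorMean Q₀ σ y) Q₀ := i2.sub (i1.smul_const _)
    rw [integral_const_mul, integral_inner i3,
      integral_sub i2 (i1.smul_const _), integral_smul_const]
    have : (∫ m, posteriorWeight σ y m ∂Q₀) • posteriorMean Q₀ σ y
        = ∫ m, posteriorWeight σ y m • m ∂Q₀ := by
      rw [posteriorMean, smul_smul, mul_inv_cancel₀ hZ.ne', one_smul]
    rw [this, sub_self, inner_zero_right, mul_zero]
  simp only [hz, integral_zero]

end Joint

/-! ### Voronoi cells and moments of the Hermite features -/

section Cells

variable {n K : ℕ} {Q₀ : Measure (Vec n)} {σ R : ℝ} {c : Fin K → Vec n}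

lemma isClosed_voronoiCell (c : Fin K → Vec n) (j : Fin K) : IsClosed (voronoiCell c j) := by
  have : voronoiCell c j = ⋂ j', {x | ‖x - c j‖ ≤ ‖x - c j'‖} := by
    ext; simp [voronoiCell]
  rw [this]
  exact isClosed_iInter fun j' => isClosed_le (by fun_prop) (by fun_prop)

lemma measurableSet_voronoiCell (c : Fin K → Vec n) (j : Fin K) :
    MeasurableSet (voronoiCell c j) := (isClosed_voronoiCell c j).measurableSet

/-- The cells cover the space, as there is at least one center. -/
lemma exists_mem_voronoiCell (hK : 0 < K) (c : Fin K → Vec n) (x : Vec n) :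
    ∃ j, x ∈ voronoiCell c j := by
  have : Nonempty (Fin K) := ⟨⟨0, hK⟩⟩
  obtain ⟨j, hj⟩ := Finite.exists_min (fun j => ‖x - c j‖)
  exact ⟨j, hj⟩

/-- Two cells meet inside the bisector hyperplane of their centers. -/
lemma volume_inter_voronoiCell {i j : Fin K} (hij : c i ≠ c j) :
    volume (voronoiCell c i ∩ voronoiCell c j) = 0 := by
  set S : AffineSubspace ℝ (Vec n) := AffineSubspace.perpBisector (c i) (c j) with hS
  have hne : S ≠ ⊤ := by
    simpa [hS, AffineSubspace.perpBisector_eq_top] using hij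
  refine measure_mono_null ?_ (Measure.addHaar_affineSubspace volume S hne)
  rintro x ⟨hi, hj⟩
  rw [SetLike.mem_coe, hS, AffineSubspace.mem_perpBisector_iff_dist_eq, dist_eq_norm, dist_eq_norm]
  exact le_antisymm (hi j) (hj i)

lemma ae_mem_voronoiCell_unique (hσ : 0 < σ) (hc : Function.Injective c) :
    ∀ᵐ y ∂(mixtureLaw Q₀ σ), ∀ i j : Fin K, i ≠ j →
      ¬ (y ∈ voronoiCell c i ∧ y ∈ voronoiCell c j) := by
  rw [ae_all_iff]; intro i
  rw [ae_all_iff]; intro j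
  by_cases hij : i = j
  · exact ae_of_all _ fun _ h => absurd hij h
  · have h0 := mixtureLaw_absolutelyContinuous (Q₀ := Q₀) hσ
      (volume_inter_voronoiCell (hc.ne hij))
    filter_upwards [measure_eq_zero_iff_ae_notMem.1 h0] with y hy _ h
    exact hy h

variable [IsProbabilityMeasure Q₀]

/-- Moments of the Hermite energy on a cell. The nearest center is at distance at most
`R + ‖ξ‖` from `μ + ξ`, whatever warm start `μ` belongs to, so that the Gaussian tails of the noise
control the energy. -/
theorem integral_hermiteEnergy_pow_le {d q : ℕ} (hd : 1 ≤ d) (hq : 1 ≤ q) (hσ : 0 < σ)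
    (hws : IsCompleteWarmStarts Q₀ c R) (hR : (R / σ) ^ 2 ≤ d) (j : Fin K) :
    Integrable (fun p => (voronoiCell c j).indicator
        (fun y => hermiteEnergy n d σ (y - c j)) p.2 ^ q) (denoisingLaw Q₀ σ) ∧
      ∫ p, (voronoiCell c j).indicator
        (fun y => hermiteEnergy n d σ (y - c j)) p.2 ^ q ∂(denoisingLaw Q₀ σ)
        ≤ (24 * q * ((n : ℝ) / d + 1)) ^ (d * q) * Real.exp d := by
  have hd' : (1 : ℝ) ≤ d := by exact_mod_cast hd
  have hq' : (1 : ℝ) ≤ q := by exact_mod_cast hq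
  have hn' : (0 : ℝ) ≤ n := Nat.cast_nonneg n
  -- with this weight, `6 r q ≤ 1 / 4` and `r q (n + d)` is a multiple of `d`
  set r : ℝ := d / (24 * q * (n + d)) with hr
  have hr0 : 0 < r := by positivity
  have hrq : r * q * (n + d) = d / 24 := by
    rw [hr]; field_simp
  have hrq1 : r * q ≤ 1 / 24 := by
    by_contra! hcon
    have : d / 24 < r * q * (n + d) := by nlinarith
    linarith
  have hr1 : 3 * r ≤ 1 / 2 := by nlinarith
  set A : ℝ := ((r ^ d)⁻¹) ^ q * Real.exp (d / 4) with hA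
  have hA0 : 0 < A := by positivity
  have hG : Measurable (fun y => (voronoiCell c j).indicator
      (fun y => hermiteEnergy n d σ (y - c j)) y ^ q) :=
    (((continuous_hermiteEnergy n d σ).measurable.comp (by fun_prop)).indicator
      (measurableSet_voronoiCell c j)).pow_const q
  have hae : ∀ᵐ m ∂Q₀, ∃ i, ‖m - c i‖ ≤ R := by
    have hmeas : MeasurableSet (⋃ j, Metric.closedBall (c j) R) :=
      MeasurableSet.iUnion fun _ => Metric.isClosed_closedBall.measurableSet
    have h := (prob_compl_eq_zero_iff (μ := Q₀) hmeas).2 hws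
    rw [ae_iff]
    convert h using 2
    ext m
    simp [dist_eq_norm]
  have hbound : ∀ᵐ z ∂(Q₀.prod (noiseLaw n σ)), ‖(voronoiCell c j).indicator
      (fun y => hermiteEnergy n d σ (y - c j)) (z.1 + z.2) ^ q‖
      ≤ A * Real.exp (6 * (r * q) * (‖z.2‖ ^ 2 / σ ^ 2)) := by
    filter_upwards [Measure.quasiMeasurePreserving_fst.ae hae] with z ⟨i, hi⟩
    by_cases hV : z.1 + z.2 ∈ voronoiCell c j
    · rw [Set.indicator_of_mem hV]
      have hE0 : 0 ≤ hermiteEnergy n d σ (z.1 + z.2 - c j) :=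
        zero_le_one.trans (one_le_hermiteEnergy _ _ _ _)
      rw [Real.norm_of_nonneg (by positivity)]
      have hR0 : 0 ≤ R := (norm_nonneg _).trans hi
      have hnorm : ‖z.1 + z.2 - c j‖ ≤ R + ‖z.2‖ := by
        refine (hV i).trans ?_
        have : z.1 + z.2 - c i = (z.1 - c i) + z.2 := by abel
        rw [this]
        exact (norm_add_le _ _).trans (by gcongr)
      have hsq : ‖z.1 + z.2 - c j‖ ^ 2 / σ ^ 2 ≤ 2 * d + 2 * (‖z.2‖ ^ 2 / σ ^ 2) := by
        have h1 : ‖z.1 + z.2 - c j‖ ^ 2 ≤ 2 * R ^ 2 + 2 * ‖z.2‖ ^ 2 := by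
          calc ‖z.1 + z.2 - c j‖ ^ 2 ≤ (R + ‖z.2‖) ^ 2 := by gcongr
            _ ≤ _ := by nlinarith [sq_nonneg (R - ‖z.2‖)]
        rw [div_pow] at hR
        calc ‖z.1 + z.2 - c j‖ ^ 2 / σ ^ 2 ≤ (2 * R ^ 2 + 2 * ‖z.2‖ ^ 2) / σ ^ 2 := by gcongr
          _ = 2 * (R ^ 2 / σ ^ 2) + 2 * (‖z.2‖ ^ 2 / σ ^ 2) := by ring
          _ ≤ _ := by gcongr
      calc hermiteEnergy n d σ (z.1 + z.2 - c j) ^ q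
          ≤ ((r ^ d)⁻¹ * Real.exp (3 * r * (‖z.1 + z.2 - c j‖ ^ 2 / σ ^ 2 + 2 * n))) ^ q := by
            gcongr
            exact hermiteEnergy_le hr0 hr1 _
        _ ≤ ((r ^ d)⁻¹ * Real.exp (3 * r * (2 * d + 2 * (‖z.2‖ ^ 2 / σ ^ 2) + 2 * n))) ^ q := by
            gcongr
        _ = A * Real.exp (6 * (r * q) * (‖z.2‖ ^ 2 / σ ^ 2)) := by
            rw [mul_pow, ← Real.exp_nat_mul, hA, mul_assoc _ (Real.exp _) (Real.exp _), ← Real.exp_add]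
            congr 2
            linear_combination 6 * hrq
    · rw [Set.indicator_of_notMem hV, zero_pow (by omega), norm_zero]
      positivity
  obtain ⟨hi, hle⟩ := integral_exp_sq_norm_noiseLaw_le (n := n) (l := 6 * (r * q)) hσ
    (by positivity) (by linarith)
  have hdom : Integrable (fun z : Vec n × Vec n =>
      A * Real.exp (6 * (r * q) * (‖z.2‖ ^ 2 / σ ^ 2))) (Q₀.prod (noiseLaw n σ)) :=
    (hi.comp_snd Q₀).const_mul A
  have hadd : Measurable (fun p : Vec n × Vec n => (p.1, p.1 + p.2)) := by fun_prop
  have hmeas2 : Measurable (fun p : Vec n × Vec n => (voronoiCell c j).indicator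
      (fun y => hermiteEnergy n d σ (y - c j)) p.2 ^ q) := hG.comp measurable_snd
  have hint : Integrable (fun z : Vec n × Vec n => (voronoiCell c j).indicator
      (fun y => hermiteEnergy n d σ (y - c j)) (z.1 + z.2) ^ q) (Q₀.prod (noiseLaw n σ)) :=
    hdom.mono' (hG.comp (by fun_prop)).aestronglyMeasurable hbound
  constructor
  · rw [denoisingLaw, integrable_map_measure hmeas2.aestronglyMeasurable hadd.aemeasurable]
    exact hint
  · rw [denoisingLaw, integral_map hadd.aemeasurable hmeas2.aestronglyMeasurable]
    have hsnd : ∫ z : Vec n × Vec n, Real.exp (6 * (r * q) * (‖z.2‖ ^ 2 / σ ^ 2))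
        ∂(Q₀.prod (noiseLaw n σ))
        = ∫ x, Real.exp (6 * (r * q) * (‖x‖ ^ 2 / σ ^ 2)) ∂(noiseLaw n σ) := by
      rw [integral_fun_snd (fun x => Real.exp (6 * (r * q) * (‖x‖ ^ 2 / σ ^ 2)))]
      simp
    calc ∫ z, (voronoiCell c j).indicator
          (fun y => hermiteEnergy n d σ (y - c j)) (z.1 + z.2) ^ q ∂(Q₀.prod (noiseLaw n σ))
        ≤ ∫ z, A * Real.exp (6 * (r * q) * (‖z.2‖ ^ 2 / σ ^ 2)) ∂(Q₀.prod (noiseLaw n σ)) :=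
          integral_mono_ae hint hdom
            (hbound.mono fun z hz => (le_abs_self _).trans hz)
      _ ≤ A * Real.exp (2 * (6 * (r * q)) * n) := by
          rw [integral_const_mul, hsnd]
          gcongr
      _ ≤ ((r ^ d)⁻¹) ^ q * Real.exp d := by
          rw [hA, mul_assoc, ← Real.exp_add]
          gcongr
          have : 0 ≤ r * q * d := by positivity
          nlinarith
      _ = _ := by
          congr 1
          rw [← inv_pow, ← pow_mul, hr, inv_div]
          congr 1
          field_simp

end Cells

/-! ### The loss as a linear functional of a feature vector -/

/-- Index set of the features: pairs of Hermite polynomials, a Hermite polynomial and a coordinate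
of the signal, and one constant. -/
abbrev FeatureIdx (n d : ℕ) : Type :=
  (MultiIdx n d × MultiIdx n d) ⊕ ((MultiIdx n d × Fin n) ⊕ Unit)

/-- The Euclidean space of feature vectors. -/
abbrev FeatureSpace (n d : ℕ) : Type := EuclideanSpace ℝ (FeatureIdx n d)

/-- The feature vector `(h_k(x) h_l(x), h_k(x) mᵢ / s, ‖z‖² / s²)` of an observation `x` (relative
to a center), a signal `m` and a posterior mean `z`. The scale `s` makes all blocks of comparable
size. -/
noncomputable def featureVec {n : ℕ} (d : ℕ) (σ s : ℝ) (x m z : Vec n) : FeatureSpace n d :=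
  WithLp.toLp 2 (Sum.elim (fun kl => hermiteMulti σ kl.1 x * hermiteMulti σ kl.2 x)
    (Sum.elim (fun ki => hermiteMulti σ ki.1 x * (m ki.2 / s)) (fun _ => ‖z‖ ^ 2 / s ^ 2)))

/-- The vector `(⟨b_k, b_l⟩, -2 s b_{k,i}, s²)` dual to `featureVec`. -/
noncomputable def coeffVec {n d : ℕ} (s : ℝ) (b : Coeffs n d) : FeatureSpace n d :=
  WithLp.toLp 2 (Sum.elim (fun kl => ⟪b kl.1, b kl.2⟫)
    (Sum.elim (fun ki => -2 * s * b ki.1 ki.2) (fun _ => s ^ 2)))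

lemma inner_coeffVec_featureVec {n d : ℕ} {σ s : ℝ} (hs : s ≠ 0) (b : Coeffs n d)
    (x m z : Vec n) :
    ⟪coeffVec s b, featureVec d σ s x m z⟫
      = ‖hermiteSum σ b x‖ ^ 2 - 2 * ⟪hermiteSum σ b x, m⟫ + ‖z‖ ^ 2 := by
  have h1 : ‖hermiteSum σ b x‖ ^ 2
      = ∑ kl : MultiIdx n d × MultiIdx n d,
        hermiteMulti σ kl.1 x * hermiteMulti σ kl.2 x * ⟪b kl.1, b kl.2⟫ := by
    rw [← real_inner_self_eq_norm_sq, hermiteSum, sum_inner, Fintype.sum_prod_type]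
    refine Finset.sum_congr rfl fun k _ => ?_
    rw [inner_sum]
    refine Finset.sum_congr rfl fun l _ => ?_
    rw [real_inner_smul_left, real_inner_smul_right]
    ring
  have h2 : ⟪hermiteSum σ b x, m⟫
      = ∑ ki : MultiIdx n d × Fin n, hermiteMulti σ ki.1 x * (b ki.1 ki.2 * m ki.2) := by
    rw [hermiteSum, sum_inner, Fintype.sum_prod_type]
    refine Finset.sum_congr rfl fun k _ => ?_
    rw [real_inner_smul_left, PiLp.inner_apply, Finset.mul_sum]
    refine Finset.sum_congr rfl fun i _ => ?_
    simp [mul_comm]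
  rw [h1, h2, PiLp.inner_apply, Fintype.sum_sum_type, Fintype.sum_sum_type]
  simp only [coeffVec, featureVec, Sum.elim_inl, Sum.elim_inr, RCLike.inner_apply, conj_trivial,
    Finset.univ_unique, Finset.sum_const, Finset.card_singleton, one_smul]
  have e1 : ‖z‖ ^ 2 / s ^ 2 * s ^ 2 = ‖z‖ ^ 2 := by field_simp
  have e2 : ∑ ki : MultiIdx n d × Fin n,
      hermiteMulti σ ki.1 x * (m ki.2 / s) * (-2 * s * b ki.1 ki.2)
      = -(2 * ∑ ki : MultiIdx n d × Fin n, hermiteMulti σ ki.1 x * (b ki.1 ki.2 * m ki.2)) := by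
    rw [Finset.mul_sum, ← Finset.sum_neg_distrib]
    refine Finset.sum_congr rfl fun ki _ => ?_
    field_simp
  rw [e1, e2]
  ring

lemma norm_coeffVec_le {n d : ℕ} {s : ℝ} (hs : 0 ≤ s) (b : Coeffs n d) :
    ‖coeffVec s b‖ ≤ (‖b‖ + s) ^ 2 := by
  have hb : ‖b‖ ^ 2 = ∑ k, ‖b k‖ ^ 2 := PiLp.norm_sq_eq_of_L2 _ b
  have h1 : ∑ kl : MultiIdx n d × MultiIdx n d, ⟪b kl.1, b kl.2⟫ ^ 2 ≤ ‖b‖ ^ 2 * ‖b‖ ^ 2 := by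
    rw [hb, Finset.sum_mul_sum, Fintype.sum_prod_type]
    refine Finset.sum_le_sum fun k _ => Finset.sum_le_sum fun l _ => ?_
    rw [← mul_pow, ← sq_abs]
    gcongr
    exact abs_real_inner_le_norm _ _
  have h2 : ∑ ki : MultiIdx n d × Fin n, (-2 * s * b ki.1 ki.2) ^ 2 = 4 * s ^ 2 * ‖b‖ ^ 2 := by
    rw [hb, Finset.mul_sum, Fintype.sum_prod_type]
    refine Finset.sum_congr rfl fun k _ => ?_
    rw [EuclideanSpace.real_norm_sq_eq, Finset.mul_sum]
    refine Finset.sum_congr rfl fun i _ => ?_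
    ring
  rw [← pow_le_pow_iff_left₀ (by positivity) (by positivity) two_ne_zero]
  rw [EuclideanSpace.real_norm_sq_eq, Fintype.sum_sum_type, Fintype.sum_sum_type]
  simp only [coeffVec, Sum.elim_inl, Sum.elim_inr, Finset.univ_unique, Finset.sum_const,
    Finset.card_singleton, one_smul]
  rw [h2]
  have hb0 := norm_nonneg b
  calc _ ≤ ‖b‖ ^ 2 * ‖b‖ ^ 2 + (4 * s ^ 2 * ‖b‖ ^ 2 + (s ^ 2) ^ 2) := by gcongr
    _ ≤ (‖b‖ ^ 2 + s ^ 2 + 2 * (‖b‖ * s)) ^ 2 := by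
      have : 0 ≤ ‖b‖ * s := by positivity
      nlinarith [sq_nonneg ‖b‖, sq_nonneg s, mul_nonneg this (sq_nonneg ‖b‖),
        mul_nonneg this (sq_nonneg s), mul_nonneg (sq_nonneg s) (sq_nonneg ‖b‖)]
    _ = _ := by ring

lemma norm_featureVec_le {n d : ℕ} {σ s : ℝ} (hs : 0 < s) {x m z : Vec n} (hm : ‖m‖ ≤ s)
    (hz : ‖z‖ ≤ s) : ‖featureVec d σ s x m z‖ ≤ 2 * hermiteEnergy n d σ x := by
  have hE := one_le_hermiteEnergy n d σ x
  have h1 : ∑ kl : MultiIdx n d × MultiIdx n d, (hermiteMulti σ kl.1 x * hermiteMulti σ kl.2 x) ^ 2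
      = hermiteEnergy n d σ x ^ 2 := by
    rw [sq (hermiteEnergy n d σ x), hermiteEnergy, Finset.sum_mul_sum, Fintype.sum_prod_type]
    simp only [mul_pow]
  have h2 : ∑ ki : MultiIdx n d × Fin n, (hermiteMulti σ ki.1 x * (m ki.2 / s)) ^ 2
      = hermiteEnergy n d σ x * (‖m‖ / s) ^ 2 := by
    rw [div_pow, EuclideanSpace.real_norm_sq_eq, hermiteEnergy, Finset.sum_div,
      Finset.sum_mul_sum, Fintype.sum_prod_type]
    simp only [mul_pow, div_pow]
  rw [← pow_le_pow_iff_left₀ (by positivity) (by positivity) two_ne_zero]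
  rw [EuclideanSpace.real_norm_sq_eq, Fintype.sum_sum_type, Fintype.sum_sum_type]
  simp only [featureVec, Sum.elim_inl, Sum.elim_inr, Finset.univ_unique, Finset.sum_const,
    Finset.card_singleton, one_smul]
  rw [h1, h2, ← div_pow]
  have e1 : (‖m‖ / s) ^ 2 ≤ 1 := pow_le_one₀ (by positivity) ((div_le_one hs).2 hm)
  have e2 : ((‖z‖ / s) ^ 2) ^ 2 ≤ 1 :=
    pow_le_one₀ (by positivity) (pow_le_one₀ (by positivity) ((div_le_one hs).2 hz))
  nlinarith

section Features

variable {n d K : ℕ} {Q₀ : Measure (Vec n)} {σ s D R : ℝ}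
  {c : Fin K → Vec n}

/-- The feature vector of a pair `(μ, y)`, set to zero off the cell of the `j`-th center. -/
noncomputable def cellFeature (d : ℕ) (Q₀ : Measure (Vec n)) (c : Fin K → Vec n) (σ s : ℝ)
    (j : Fin K) (p : Vec n × Vec n) : FeatureSpace n d :=
  (voronoiCell c j).indicator
    (fun y => featureVec d σ s (y - c j) p.1 (posteriorMean Q₀ σ y)) p.2

/-- The loss in a cell is linear in the features, up to the pure noise terms. -/
lemma indicator_sq_norm_sub (hs : s ≠ 0) (j : Fin K) (b : Coeffs n d) (p : Vec n × Vec n) :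
    (voronoiCell c j).indicator (fun y => ‖hermiteSum σ b (y - c j) - p.1‖ ^ 2) p.2
      = ⟪coeffVec s b, cellFeature d Q₀ c σ s j p⟫
        + 2 * (voronoiCell c j).indicator
          (fun y => ⟪posteriorMean Q₀ σ y, p.1 - posteriorMean Q₀ σ y⟫) p.2
        + (voronoiCell c j).indicator (fun y => ‖p.1 - posteriorMean Q₀ σ y‖ ^ 2) p.2 := by
  by_cases h : p.2 ∈ voronoiCell c j
  · simp only [cellFeature, Set.indicator_of_mem h]
    rw [inner_coeffVec_featureVec hs, norm_sub_sq_real, norm_sub_sq_real, inner_sub_right,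
      real_inner_self_eq_norm_sq, real_inner_comm (posteriorMean Q₀ σ p.2) p.1]
    ring
  · simp [cellFeature, Set.indicator_of_notMem h]

variable [IsProbabilityMeasure Q₀]

lemma measurable_cellFeature (j : Fin K) : Measurable (cellFeature d Q₀ c σ s j) := by
  have h : Measurable (fun p : Vec n × Vec n =>
      featureVec d σ s (p.2 - c j) p.1 (posteriorMean Q₀ σ p.2)) := by
    refine (WithLp.measurable_toLp 2 _).comp (measurable_pi_iff.2 fun a => ?_)
    have hk : ∀ k : MultiIdx n d,
        Measurable fun p : Vec n × Vec n => hermiteMulti σ k (p.2 - c j) := fun k =>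
      (continuous_hermiteMulti σ k).measurable.comp (by fun_prop)
    rcases a with ⟨k, l⟩ | ⟨k, i⟩ | _
    · exact (hk k).mul (hk l)
    · exact (hk k).mul (by fun_prop)
    · exact ((measurable_posteriorMean.comp measurable_snd).norm.pow_const 2).div_const _
  exact h.indicator (measurable_snd (measurableSet_voronoiCell c j))

lemma norm_cellFeature_le (hs : 0 < s) (hDs : D ≤ s) (hD : Q₀ (Metric.closedBall 0 D) = 1)
    (j : Fin K) : ∀ᵐ p ∂(denoisingLaw Q₀ σ), ‖cellFeature d Q₀ c σ s j p‖ ≤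
      2 * (voronoiCell c j).indicator (fun y => hermiteEnergy n d σ (y - c j)) p.2 := by
  filter_upwards [ae_denoisingLaw_of_ae (ae_norm_le hD)] with p hp
  by_cases h : p.2 ∈ voronoiCell c j
  · simp only [cellFeature, Set.indicator_of_mem h]
    exact norm_featureVec_le hs (hp.trans hDs) ((norm_posteriorMean_le hD _).trans hDs)
  · simp [cellFeature, Set.indicator_of_notMem h]

/-- Moments of the feature vector. -/
lemma integral_norm_cellFeature_pow_le {q : ℕ} (hd : 1 ≤ d) (hq : 1 ≤ q) (hσ : 0 < σ)
    (hs : 0 < s) (hDs : D ≤ s) (hD : Q₀ (Metric.closedBall 0 D) = 1)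
    (hws : IsCompleteWarmStarts Q₀ c R) (hR : (R / σ) ^ 2 ≤ d) (j : Fin K) :
    MemLp (cellFeature d Q₀ c σ s j) (q : ENNReal) (denoisingLaw Q₀ σ) ∧
      ∫ p, ‖cellFeature d Q₀ c σ s j p‖ ^ q ∂(denoisingLaw Q₀ σ)
        ≤ (2 * (72 * q * ((n : ℝ) / d + 1)) ^ d) ^ q := by
  obtain ⟨hi, hle⟩ := integral_hermiteEnergy_pow_le hd hq hσ hws hR j
  have hb := norm_cellFeature_le (d := d) (c := c) (σ := σ) hs hDs hD j
  have hm := (measurable_cellFeature (d := d) (Q₀ := Q₀) (c := c) (σ := σ) (s := s)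
    j).aestronglyMeasurable (μ := denoisingLaw Q₀ σ)
  have hb' : ∀ᵐ p ∂(denoisingLaw Q₀ σ), ‖cellFeature d Q₀ c σ s j p‖ ^ q ≤
      2 ^ q * (voronoiCell c j).indicator (fun y => hermiteEnergy n d σ (y - c j)) p.2 ^ q := by
    filter_upwards [hb] with p hp
    rw [← mul_pow]
    gcongr
  have hint : Integrable (fun p => ‖cellFeature d Q₀ c σ s j p‖ ^ q) (denoisingLaw Q₀ σ) := by
    refine (hi.const_mul (2 ^ q)).mono' (hm.norm.pow q) ?_
    filter_upwards [hb'] with p hp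
    rwa [norm_pow, norm_norm]
  refine ⟨?_, ?_⟩
  · rw [← integrable_norm_rpow_iff hm (by exact_mod_cast (by omega : q ≠ 0)) (by simp)]
    simpa using hint
  · have hexp : Real.exp d ≤ 3 ^ (d * q) := by
      have h1 : Real.exp 1 ≤ 3 := by linarith [Real.exp_one_lt_d9]
      calc Real.exp d = Real.exp 1 ^ d := by rw [← Real.exp_nat_mul, mul_one]
        _ ≤ 3 ^ d := by gcongr
        _ ≤ 3 ^ (d * q) := pow_le_pow_right₀ (by norm_num) (Nat.le_mul_of_pos_right d hq)
    calc ∫ p, ‖cellFeature d Q₀ c σ s j p‖ ^ q ∂(denoisingLaw Q₀ σ)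
        ≤ ∫ p, 2 ^ q * (voronoiCell c j).indicator
            (fun y => hermiteEnergy n d σ (y - c j)) p.2 ^ q ∂(denoisingLaw Q₀ σ) :=
          integral_mono_ae hint (hi.const_mul _) hb'
      _ ≤ 2 ^ q * ((24 * q * ((n : ℝ) / d + 1)) ^ (d * q) * 3 ^ (d * q)) := by
          rw [integral_const_mul]
          gcongr
          exact hle.trans (by gcongr)
      _ = _ := by
          rw [← mul_pow, mul_pow _ _ q, ← pow_mul]
          congr 2
          ring

lemma integrable_indicator_sq_norm_residual (hD : Q₀ (Metric.closedBall 0 D) = 1) (j : Fin K) :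
    Integrable (fun p => (voronoiCell c j).indicator
      (fun y => ‖p.1 - posteriorMean Q₀ σ y‖ ^ 2) p.2) (denoisingLaw Q₀ σ) := by
  have hmeas : Measurable fun p : Vec n × Vec n => (voronoiCell c j).indicator
      (fun y => ‖p.1 - posteriorMean Q₀ σ y‖ ^ 2) p.2 :=
    ((measurable_fst.sub (measurable_posteriorMean.comp measurable_snd)).norm.pow_const
      2).indicator (measurable_snd (measurableSet_voronoiCell c j))
  refine (integrable_const ((D + D) ^ 2)).mono' hmeas.aestronglyMeasurable ?_
  filter_upwards [ae_denoisingLaw_of_ae (ae_norm_le hD)] with p hp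
  refine (norm_indicator_le_norm_self (fun y => ‖p.1 - posteriorMean Q₀ σ y‖ ^ 2) _).trans ?_
  rw [norm_pow, norm_norm]
  gcongr
  exact (norm_sub_le _ _).trans (add_le_add hp (norm_posteriorMean_le hD _))

/-- Orthogonality of the residual to functions of the observation, restricted to a cell. -/
lemma integral_indicator_inner_residual (hσ : 0 < σ) (hD : Q₀ (Metric.closedBall 0 D) = 1)
    {j : Fin K} {g : Vec n → Vec n} (hg : Measurable g)
    (hgi : Integrable (fun p => (voronoiCell c j).indicator g p.2) (denoisingLaw Q₀ σ)) :
    Integrable (fun p => (voronoiCell c j).indicator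
        (fun y => ⟪g y, p.1 - posteriorMean Q₀ σ y⟫) p.2) (denoisingLaw Q₀ σ) ∧
      ∫ p, (voronoiCell c j).indicator
        (fun y => ⟪g y, p.1 - posteriorMean Q₀ σ y⟫) p.2 ∂(denoisingLaw Q₀ σ) = 0 := by
  have h := integral_inner_sub_posteriorMean hσ hD
    (hg.indicator (measurableSet_voronoiCell c j)) hgi
  have e : ∀ p : Vec n × Vec n, (voronoiCell c j).indicator
      (fun y => ⟪g y, p.1 - posteriorMean Q₀ σ y⟫) p.2
      = ⟪(voronoiCell c j).indicator g p.2, p.1 - posteriorMean Q₀ σ p.2⟫ := fun p => by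
    by_cases h : p.2 ∈ voronoiCell c j
    · simp only [Set.indicator_of_mem h]
    · simp [Set.indicator_of_notMem h]
  simpa only [e] using h

/-- The shifted error is the pairing of the coefficient vector with the deviation of the empirical
mean of the features. -/
theorem shiftedErr_eq_inner {N : ℕ} (hN : 0 < N) (hd : 1 ≤ d) (hσ : 0 < σ) (hs : 0 < s)
    (hDs : D ≤ s) (hD : Q₀ (Metric.closedBall 0 D) = 1) (hws : IsCompleteWarmStarts Q₀ c R)
    (hR : (R / σ) ^ 2 ≤ d) (j : Fin K) (S : Fin N → Vec n × Vec n) (b : Coeffs n d) :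
    shiftedErr Q₀ c σ j S b = ⟪coeffVec s b, (1 / (N : ℝ)) • ∑ i, (cellFeature d Q₀ c σ s j (S i)
      - ∫ p, cellFeature d Q₀ c σ s j p ∂(denoisingLaw Q₀ σ))⟫ := by
  have hN' : (N : ℝ) ≠ 0 := by exact_mod_cast hN.ne'
  have hL := (integral_norm_cellFeature_pow_le (q := 1) hd le_rfl hσ hs hDs hD hws hR j).1
  rw [Nat.cast_one, memLp_one_iff_integrable] at hL
  have hm : Measurable (posteriorMean Q₀ σ) := measurable_posteriorMean
  have hz : Integrable (fun p => (voronoiCell c j).indicator (posteriorMean Q₀ σ) p.2)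
      (denoisingLaw Q₀ σ) := by
    refine (integrable_const D).mono' ((hm.indicator
      (measurableSet_voronoiCell c j)).comp measurable_snd).aestronglyMeasurable
      (ae_of_all _ fun p => ?_)
    exact (norm_indicator_le_norm_self _ _).trans (norm_posteriorMean_le hD _)
  obtain ⟨i2, h2⟩ := integral_indicator_inner_residual hσ hD hm hz
  have i3 := integrable_indicator_sq_norm_residual (σ := σ) (c := c) hD j
  have i1 : Integrable (fun p => ⟪coeffVec s b, cellFeature d Q₀ c σ s j p⟫)
      (denoisingLaw Q₀ σ) := hL.const_inner _
  have hpop : populationRisk Q₀ c σ j b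
      = ⟪coeffVec s b, ∫ p, cellFeature d Q₀ c σ s j p ∂(denoisingLaw Q₀ σ)⟫
        + ∫ p, (voronoiCell c j).indicator
          (fun y => ‖p.1 - posteriorMean Q₀ σ y‖ ^ 2) p.2 ∂(denoisingLaw Q₀ σ) := by
    rw [populationRisk]
    simp_rw [indicator_sq_norm_sub (Q₀ := Q₀) hs.ne' j b]
    have i12 : Integrable (fun p => ⟪coeffVec s b, cellFeature d Q₀ c σ s j p⟫
        + 2 * (voronoiCell c j).indicator
          (fun y => ⟪posteriorMean Q₀ σ y, p.1 - posteriorMean Q₀ σ y⟫) p.2)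
        (denoisingLaw Q₀ σ) := i1.add (i2.const_mul 2)
    rw [integral_add i12 i3, integral_add i1 (i2.const_mul 2), integral_const_mul, h2,
      integral_inner hL]
    ring
  rw [shiftedErr, empiricalRisk, hpop, real_inner_smul_right, inner_sum]
  simp_rw [indicator_sq_norm_sub (Q₀ := Q₀) hs.ne' j b, inner_sub_right]
  rw [Finset.sum_add_distrib, Finset.sum_add_distrib, Finset.sum_sub_distrib, ← Finset.mul_sum]
  simp only [Finset.sum_const, Finset.card_univ, Fintype.card_fin, nsmul_eq_mul]
  field_simp
  ring

end Features

/-! ### Deviation of the empirical features -/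

lemma integral_norm_sub_integral_pow_le {Ω H : Type*} {mΩ : MeasurableSpace Ω} {P : Measure Ω}
    [IsProbabilityMeasure P] [NormedAddCommGroup H] [NormedSpace ℝ H] {X : Ω → H}
    {m : ℕ} (hm : 1 ≤ m) (hX : MemLp X (m : ENNReal) P) :
    ∫ ω, ‖X ω - ∫ ω', X ω' ∂P‖ ^ m ∂P ≤ 2 ^ m * ∫ ω, ‖X ω‖ ^ m ∂P := by
  have hX1 : Integrable X P := hX.integrable (by exact_mod_cast hm)
  have hi : Integrable (fun ω => ‖X ω‖ ^ m) P := hX.integrable_norm_pow (by omega)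
  have hic : Integrable (fun ω => ‖X ω - ∫ ω', X ω' ∂P‖ ^ m) P :=
    (hX.sub (memLp_const _)).integrable_norm_pow (by omega)
  have hjensen : ‖∫ ω, X ω ∂P‖ ^ m ≤ ∫ ω, ‖X ω‖ ^ m ∂P := by
    calc ‖∫ ω, X ω ∂P‖ ^ m ≤ (∫ ω, ‖X ω‖ ∂P) ^ m := by
          gcongr
          exact norm_integral_le_integral_norm _
      _ ≤ ∫ ω, ‖X ω‖ ^ m ∂P :=
          (convexOn_pow m).map_integral_le (continuous_pow m).continuousOn isClosed_Ici
            (ae_of_all _ fun ω => norm_nonneg _) hX1.norm hi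
  have hpt : ∀ ω, ‖X ω - ∫ ω', X ω' ∂P‖ ^ m
      ≤ 2 ^ (m - 1) * (‖X ω‖ ^ m + ‖∫ ω', X ω' ∂P‖ ^ m) := fun ω =>
    (pow_le_pow_left₀ (norm_nonneg _) (norm_sub_le _ _) m).trans
      (add_pow_le (norm_nonneg _) (norm_nonneg _) m)
  have hi2 : Integrable (fun ω => ‖X ω‖ ^ m + ‖∫ ω', X ω' ∂P‖ ^ m) P :=
    hi.add (integrable_const _)
  calc ∫ ω, ‖X ω - ∫ ω', X ω' ∂P‖ ^ m ∂P
      ≤ ∫ ω, 2 ^ (m - 1) * (‖X ω‖ ^ m + ‖∫ ω', X ω' ∂P‖ ^ m) ∂P :=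
        integral_mono hic (hi2.const_mul _) hpt
    _ = 2 ^ (m - 1) * (∫ ω, ‖X ω‖ ^ m ∂P + ‖∫ ω, X ω ∂P‖ ^ m) := by
        rw [integral_const_mul, integral_add hi (integrable_const _)]
        simp
    _ ≤ 2 ^ (m - 1) * (∫ ω, ‖X ω‖ ^ m ∂P + ∫ ω, ‖X ω‖ ^ m ∂P) := by gcongr
    _ = 2 ^ (m - 1) * 2 * ∫ ω, ‖X ω‖ ^ m ∂P := by ring
    _ = _ := by rw [← pow_succ, Nat.sub_add_cancel hm]

section Deviation

variable {n d K N : ℕ} {Q₀ : Measure (Vec n)} [IsProbabilityMeasure Q₀] {σ s D R : ℝ}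
  {c : Fin K → Vec n}

/-- Deviation of the empirical mean of the features from their expectation. -/
noncomputable def featureDeviation (d : ℕ) (Q₀ : Measure (Vec n)) (c : Fin K → Vec n) (σ s : ℝ)
    (j : Fin K) (S : Fin N → Vec n × Vec n) : FeatureSpace n d :=
  (1 / (N : ℝ)) • ∑ i, (cellFeature d Q₀ c σ s j (S i)
    - ∫ p, cellFeature d Q₀ c σ s j p ∂(denoisingLaw Q₀ σ))

/-- Markov's inequality for the moment of order `2 (p + 1)` of the deviation. -/
theorem measure_featureDeviation_le {Ω : Type*} {mΩ : MeasurableSpace Ω} {P : Measure Ω}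
    [IsProbabilityMeasure P] {S : Fin N → Ω → Vec n × Vec n} (hN : 0 < N) (hd : 1 ≤ d) (hσ : 0 < σ)
    (hs : 0 < s) (hDs : D ≤ s) (hD : Q₀ (Metric.closedBall 0 D) = 1)
    (hws : IsCompleteWarmStarts Q₀ c R) (hR : (R / σ) ^ 2 ≤ d) (j : Fin K)
    (hlaw : ∀ i, HasLaw (S i) (denoisingLaw Q₀ σ) P) (hind : iIndepFun S P)
    (p : ℕ) {t : ℝ} (ht : 0 < t)
    (hNt : 48 * ((p : ℝ) + 1) ^ 2 * (4 * (144 * (p + 1) * ((n : ℝ) / d + 1)) ^ d) ^ 2 ≤ N * t ^ 2) :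
    P {ω | t < ‖featureDeviation d Q₀ c σ s j (fun i => S i ω)‖}
      ≤ ENNReal.ofReal (Real.exp (-((p : ℝ) + 1))) := by
  have hN' : (0 : ℝ) < N := by exact_mod_cast hN
  set W : ℝ := 4 * (144 * (p + 1) * ((n : ℝ) / d + 1)) ^ d with hW
  have hW0 : 0 ≤ W := by positivity
  set e := ∫ p, cellFeature d Q₀ c σ s j p ∂(denoisingLaw Q₀ σ) with he
  obtain ⟨hL, hle⟩ := integral_norm_cellFeature_pow_le (q := 2 * (p + 1)) hd (by omega) hσ hs hDs
    hD hws hR j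
  have hmeas := measurable_cellFeature (d := d) (Q₀ := Q₀) (c := c) (σ := σ) (s := s) j
  set X : Fin N → Ω → FeatureSpace n d := fun i ω => cellFeature d Q₀ c σ s j (S i ω) - e with hX
  have hmeas' : Measurable fun z => cellFeature d Q₀ c σ s j z - e := hmeas.sub_const e
  have hXm : ∀ i, AEMeasurable (X i) P := fun i =>
    hmeas'.comp_aemeasurable (hlaw i).aemeasurable
  have hXind : iIndepFun X P := hind.comp (fun _ z => cellFeature d Q₀ c σ s j z - e)
    fun _ => hmeas'
  have hLe : MemLp (fun z => cellFeature d Q₀ c σ s j z - e) ((2 * (p + 1) : ℕ) : ENNReal)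
      (denoisingLaw Q₀ σ) := hL.sub (memLp_const e)
  have hXL : ∀ i, MemLp (X i) ((2 * (p + 1) : ℕ) : ENNReal) P := fun i => by
    have h := hLe
    rw [← (hlaw i).map_eq] at h
    exact h.comp_of_map (hlaw i).aemeasurable
  have hX0 : ∀ i, ∫ ω, X i ω ∂P = 0 := fun i => by
    have hL1 : Integrable (cellFeature d Q₀ c σ s j) (denoisingLaw Q₀ σ) :=
      hL.integrable (by norm_cast; omega)
    refine ((hlaw i).integral_comp hmeas'.aestronglyMeasurable).trans ?_
    rw [integral_sub hL1 (integrable_const e), ← he]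
    simp
  have hXB : ∀ i, ∫ ω, ‖X i ω‖ ^ (2 * (p + 1)) ∂P ≤ W ^ (2 * (p + 1)) := fun i => by
    refine ((hlaw i).integral_comp
      (hmeas'.norm.pow_const (2 * (p + 1))).aestronglyMeasurable).trans_le ?_
    calc _ ≤ 2 ^ (2 * (p + 1)) * ∫ z, ‖cellFeature d Q₀ c σ s j z‖ ^ (2 * (p + 1))
          ∂(denoisingLaw Q₀ σ) := integral_norm_sub_integral_pow_le (by omega) hL
      _ ≤ 2 ^ (2 * (p + 1)) *
          (2 * (72 * (2 * (p + 1) : ℕ) * ((n : ℝ) / d + 1)) ^ d) ^ (2 * (p + 1)) := by gcongr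
      _ = W ^ (2 * (p + 1)) := by
          rw [← mul_pow, hW]
          congr 1
          push_cast
          ring
  have hsum := integral_norm_sum_pow_le hXind hXm p hXL hX0 hXB Finset.univ
  rw [Finset.card_univ, Fintype.card_fin] at hsum
  have hint : Integrable (fun ω => ‖∑ i, X i ω‖ ^ (2 * (p + 1))) P :=
    (memLp_finsetSum Finset.univ fun i _ => hXL i).integrable_norm_pow (by omega)
  have hmarkov := mul_meas_ge_le_integral_of_nonneg
    (ae_of_all _ fun ω => by positivity) hint ((N * t) ^ (2 * (p + 1)))
  have hsub : {ω | t < ‖featureDeviation d Q₀ c σ s j (fun i => S i ω)‖}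
      ⊆ {ω | (N * t) ^ (2 * (p + 1)) ≤ ‖∑ i, X i ω‖ ^ (2 * (p + 1))} := fun ω hω => by
    have hω' : t < ‖(1 / (N : ℝ)) • ∑ i, X i ω‖ := hω
    rw [norm_smul, Real.norm_of_nonneg (by positivity), one_div, inv_mul_eq_div,
      lt_div_iff₀ hN'] at hω'
    change (N * t) ^ (2 * (p + 1)) ≤ ‖∑ i, X i ω‖ ^ (2 * (p + 1))
    gcongr
    linarith
  refine (measure_mono hsub).trans ?_
  rw [← ofReal_measureReal]
  refine ENNReal.ofReal_le_ofReal ?_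
  have hNt0 : 0 < (N * t) ^ (2 * (p + 1)) := by positivity
  refine le_of_mul_le_mul_left (hmarkov.trans (hsum.trans ?_)) hNt0
  have h3 : (1 / 3 : ℝ) ^ (p + 1) ≤ Real.exp (-((p : ℝ) + 1)) := by
    have h1 : (1 / 3 : ℝ) ≤ Real.exp (-1) := by
      rw [Real.exp_neg, ← one_div]
      gcongr
      linarith [Real.exp_one_lt_d9]
    calc (1 / 3 : ℝ) ^ (p + 1) ≤ Real.exp (-1) ^ (p + 1) := by gcongr
      _ = _ := by
        rw [← Real.exp_nat_mul]
        push_cast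
        ring_nf
  calc (16 * ((p : ℝ) + 1) ^ 2 * N) ^ (p + 1) * W ^ (2 * (p + 1))
      = (16 * ((p : ℝ) + 1) ^ 2 * W ^ 2 * N) ^ (p + 1) := by
        rw [pow_mul W, ← mul_pow]
        ring_nf
    _ ≤ ((N * t) ^ 2 * (1 / 3)) ^ (p + 1) := by
        refine pow_le_pow_left₀ (by positivity) ?_ _
        have := mul_le_mul_of_nonneg_right hNt hN'.le
        linarith
    _ = (N * t) ^ (2 * (p + 1)) * (1 / 3) ^ (p + 1) := by
        rw [mul_pow, ← pow_mul]
    _ ≤ _ := by gcongr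

end Deviation

/-! ### Decomposition of the risk -/

section Risk

variable {n d K : ℕ} {Q₀ : Measure (Vec n)} {σ D R : ℝ}
  {c : Fin K → Vec n}

/-- Almost surely, the observation lies in exactly one cell. -/
lemma piecewisePoly_sub_ae_eq (hσ : 0 < σ) (hK : 0 < K) (hc : Function.Injective c)
    (b : Fin K → Coeffs n d) :
    ∀ᵐ y ∂(mixtureLaw Q₀ σ), ∃ i : Fin K,
      (piecewisePoly c σ b y - posteriorMean Q₀ σ y
        = hermiteSum σ (b i) (y - c i) - posteriorMean Q₀ σ y) ∧
      ∀ j, (voronoiCell c j).indicator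
          (fun y => hermiteSum σ (b j) (y - c j) - posteriorMean Q₀ σ y) y
        = if j = i then hermiteSum σ (b i) (y - c i) - posteriorMean Q₀ σ y else 0 := by
  filter_upwards [ae_mem_voronoiCell_unique hσ hc] with y hy
  obtain ⟨i, hi⟩ := exists_mem_voronoiCell hK c y
  have hne : ∀ j, j ≠ i → y ∉ voronoiCell c j := fun j hj h => hy j i hj ⟨h, hi⟩
  refine ⟨i, ?_, fun j => ?_⟩
  · rw [piecewisePoly, Finset.sum_eq_single i
      (fun j _ hj => Set.indicator_of_notMem (hne j hj) _) (by simp), Set.indicator_of_mem hi]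
  · split_ifs with h
    · subst h
      rw [Set.indicator_of_mem hi]
    · exact Set.indicator_of_notMem (hne j h) _

variable [IsProbabilityMeasure Q₀]

lemma measurable_cell_error (j : Fin K) (b : Coeffs n d) :
    Measurable (fun y => hermiteSum σ b (y - c j) - posteriorMean Q₀ σ y) :=
  ((continuous_hermiteSum σ b).measurable.comp (by fun_prop)).sub measurable_posteriorMean

lemma memLp_cell_error (hd : 1 ≤ d) (hσ : 0 < σ) (hD : Q₀ (Metric.closedBall 0 D) = 1)
    (hws : IsCompleteWarmStarts Q₀ c R) (hR : (R / σ) ^ 2 ≤ d) (j : Fin K) (b : Coeffs n d) :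
    MemLp ((voronoiCell c j).indicator
      (fun y => hermiteSum σ b (y - c j) - posteriorMean Q₀ σ y)) 2 (mixtureLaw Q₀ σ) := by
  have hm : Measurable ((voronoiCell c j).indicator
      (fun y => hermiteSum σ b (y - c j) - posteriorMean Q₀ σ y)) :=
    (measurable_cell_error j b).indicator (measurableSet_voronoiCell c j)
  have hE := (integral_hermiteEnergy_pow_le (q := 1) hd le_rfl hσ hws hR j).1
  simp only [pow_one] at hE
  rw [memLp_two_iff_integrable_sq_norm hm.aestronglyMeasurable, ← map_snd_denoisingLaw,
    integrable_map_measure (hm.norm.pow_const 2).aestronglyMeasurable measurable_snd.aemeasurable]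
  refine ((hE.const_mul (2 * ‖b‖ ^ 2)).add (integrable_const (2 * D ^ 2))).mono'
    ((hm.norm.pow_const 2).comp measurable_snd).aestronglyMeasurable (ae_of_all _ fun p => ?_)
  simp only [Function.comp, norm_pow, norm_norm, Pi.add_apply]
  by_cases h : p.2 ∈ voronoiCell c j
  · simp only [Set.indicator_of_mem h]
    have h1 := norm_hermiteSum_sq_le σ b (p.2 - c j)
    have h2 := norm_posteriorMean_le (σ := σ) hD p.2
    have h3 := norm_sub_le (hermiteSum σ b (p.2 - c j)) (posteriorMean Q₀ σ p.2)
    have h4 : ‖posteriorMean Q₀ σ p.2‖ ^ 2 ≤ D ^ 2 := by gcongr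
    calc _ ≤ (‖hermiteSum σ b (p.2 - c j)‖ + ‖posteriorMean Q₀ σ p.2‖) ^ 2 := by gcongr
      _ ≤ 2 * ‖hermiteSum σ b (p.2 - c j)‖ ^ 2 + 2 * ‖posteriorMean Q₀ σ p.2‖ ^ 2 := by
        nlinarith [sq_nonneg (‖hermiteSum σ b (p.2 - c j)‖ - ‖posteriorMean Q₀ σ p.2‖)]
      _ ≤ _ := by linarith
  · simp only [Set.indicator_of_notMem h, norm_zero]
    nlinarith [sq_nonneg D]

/-- Bias-variance decomposition of the population risk in a cell. -/
lemma populationRisk_eq_add (hd : 1 ≤ d) (hσ : 0 < σ) (hD : Q₀ (Metric.closedBall 0 D) = 1)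
    (hws : IsCompleteWarmStarts Q₀ c R) (hR : (R / σ) ^ 2 ≤ d) (j : Fin K) (b : Coeffs n d) :
    populationRisk Q₀ c σ j b
      = ∫ y, ‖(voronoiCell c j).indicator
          (fun y => hermiteSum σ b (y - c j) - posteriorMean Q₀ σ y) y‖ ^ 2 ∂(mixtureLaw Q₀ σ)
        + ∫ p, (voronoiCell c j).indicator
          (fun y => ‖p.1 - posteriorMean Q₀ σ y‖ ^ 2) p.2 ∂(denoisingLaw Q₀ σ) := by
  set g : Vec n → Vec n := fun y => hermiteSum σ b (y - c j) - posteriorMean Q₀ σ y with hg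
  have hgm : Measurable g := measurable_cell_error j b
  have hm : Measurable ((voronoiCell c j).indicator g) :=
    hgm.indicator (measurableSet_voronoiCell c j)
  have hL : MemLp ((voronoiCell c j).indicator g) 2 (mixtureLaw Q₀ σ) :=
    memLp_cell_error hd hσ hD hws hR j b
  rw [← map_snd_denoisingLaw] at hL ⊢
  have hL' : MemLp (fun p : Vec n × Vec n => (voronoiCell c j).indicator g p.2) 2
      (denoisingLaw Q₀ σ) := hL.comp_of_map measurable_snd.aemeasurable
  obtain ⟨i2, h2⟩ := integral_indicator_inner_residual hσ hD hgm (hL'.integrable one_le_two)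
  have i3 := integrable_indicator_sq_norm_residual (σ := σ) (c := c) hD j
  have i1 : Integrable (fun p : Vec n × Vec n => ‖(voronoiCell c j).indicator g p.2‖ ^ 2)
      (denoisingLaw Q₀ σ) := hL'.integrable_norm_pow two_ne_zero
  have e : ∀ p : Vec n × Vec n, (voronoiCell c j).indicator
      (fun y => ‖hermiteSum σ b (y - c j) - p.1‖ ^ 2) p.2
      = ‖(voronoiCell c j).indicator g p.2‖ ^ 2 + (-2) * (voronoiCell c j).indicator
          (fun y => ⟪g y, p.1 - posteriorMean Q₀ σ y⟫) p.2
        + (voronoiCell c j).indicator (fun y => ‖p.1 - posteriorMean Q₀ σ y‖ ^ 2) p.2 := fun p => by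
    by_cases h : p.2 ∈ voronoiCell c j
    · simp only [Set.indicator_of_mem h, hg]
      have : hermiteSum σ b (p.2 - c j) - p.1 = (hermiteSum σ b (p.2 - c j)
        - posteriorMean Q₀ σ p.2) - (p.1 - posteriorMean Q₀ σ p.2) := by abel
      rw [this, norm_sub_sq_real (_ - _)]
      ring
    · simp [Set.indicator_of_notMem h]
  have i12 : Integrable (fun p : Vec n × Vec n => ‖(voronoiCell c j).indicator g p.2‖ ^ 2
      + (-2) * (voronoiCell c j).indicator (fun y => ⟪g y, p.1 - posteriorMean Q₀ σ y⟫) p.2)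
      (denoisingLaw Q₀ σ) := i1.add (i2.const_mul (-2))
  rw [populationRisk]
  simp_rw [e]
  rw [integral_add i12 i3, integral_add i1 (i2.const_mul (-2)), integral_const_mul, h2,
    integral_map measurable_snd.aemeasurable (hm.norm.pow_const 2).aestronglyMeasurable]
  ring

lemma memLp_piecewisePoly_sub (hd : 1 ≤ d) (hσ : 0 < σ) (hD : Q₀ (Metric.closedBall 0 D) = 1)
    (hK : 0 < K) (hc : Function.Injective c) (hws : IsCompleteWarmStarts Q₀ c R)
    (hR : (R / σ) ^ 2 ≤ d) (b : Fin K → Coeffs n d) :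
    MemLp (fun y => piecewisePoly c σ b y - posteriorMean Q₀ σ y) 2 (mixtureLaw Q₀ σ) := by
  refine (memLp_congr_ae ?_).1 (memLp_finsetSum Finset.univ fun j _ =>
    memLp_cell_error hd hσ hD hws hR j (b j))
  filter_upwards [piecewisePoly_sub_ae_eq (Q₀ := Q₀) hσ hK hc b] with y ⟨i, hi, hj⟩
  simp [hi, hj]

lemma l2Dist_sq_eq_sum (hd : 1 ≤ d) (hσ : 0 < σ) (hD : Q₀ (Metric.closedBall 0 D) = 1)
    (hK : 0 < K) (hc : Function.Injective c) (hws : IsCompleteWarmStarts Q₀ c R)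
    (hR : (R / σ) ^ 2 ≤ d) (b : Fin K → Coeffs n d) :
    l2Dist Q₀ c σ b ^ 2 = ∑ j, ∫ y, ‖(voronoiCell c j).indicator
      (fun y => hermiteSum σ (b j) (y - c j) - posteriorMean Q₀ σ y) y‖ ^ 2
        ∂(mixtureLaw Q₀ σ) := by
  have hL := memLp_piecewisePoly_sub hd hσ hD hK hc hws hR b
  have h1 : l2Dist Q₀ c σ b ^ 2
      = ∫ y, ‖piecewisePoly c σ b y - posteriorMean Q₀ σ y‖ ^ 2 ∂(mixtureLaw Q₀ σ) := by
    rw [l2Dist, hL.eLpNorm_eq_integral_rpow_norm two_ne_zero ENNReal.ofNat_ne_top,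
      ENNReal.toReal_ofReal (by positivity), ← Real.rpow_natCast, ← Real.rpow_mul (by positivity)]
    simp
  rw [h1, ← integral_finsetSum _ fun j _ =>
    (memLp_cell_error hd hσ hD hws hR j (b j)).integrable_norm_pow two_ne_zero]
  refine integral_congr_ae ?_
  filter_upwards [piecewisePoly_sub_ae_eq (Q₀ := Q₀) hσ hK hc b] with y ⟨i, hi, hj⟩
  rw [hi, Finset.sum_eq_single i]
  · rw [hj i, if_pos rfl]
  · intro j _ hji
    rw [hj j, if_neg hji]
    simp
  · simp

/-- The excess risk of empirical minimizers is controlled by the uniform bound `τ` on the shifted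
error, since the part removed from the empirical error does not depend on the coefficients. -/
theorem l2Dist_sq_sub_le {N : ℕ} {M τ : ℝ} (hd : 1 ≤ d) (hσ : 0 < σ)
    (hD : Q₀ (Metric.closedBall 0 D) = 1)
    (hK : 0 < K) (hc : Function.Injective c) (hws : IsCompleteWarmStarts Q₀ c R)
    (hR : (R / σ) ^ 2 ≤ d) {S : Fin N → Vec n × Vec n}
    (herr : ∀ j, ∀ b ∈ Metric.closedBall (0 : Coeffs n d) M, |shiftedErr Q₀ c σ j S b| ≤ τ)
    {bhat btilde : Fin K → Coeffs n d} (hhat : ∀ j, IsERM c σ M j S (bhat j))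
    (htilde : ∀ j, btilde j ∈ Metric.closedBall (0 : Coeffs n d) M) :
    l2Dist Q₀ c σ bhat ^ 2 - l2Dist Q₀ c σ btilde ^ 2 ≤ K * (2 * τ) := by
  rw [l2Dist_sq_eq_sum hd hσ hD hK hc hws hR, l2Dist_sq_eq_sum hd hσ hD hK hc hws hR,
    ← Finset.sum_sub_distrib]
  refine (Finset.sum_le_card_nsmul Finset.univ _ (2 * τ) fun j _ => ?_).trans (by simp)
  have p1 := populationRisk_eq_add hd hσ hD hws hR j (bhat j)
  have p2 := populationRisk_eq_add hd hσ hD hws hR j (btilde j)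
  have e1 := (abs_le.1 (herr j _ (hhat j).1)).1
  have e2 := (abs_le.1 (herr j _ (htilde j))).2
  have e3 := (hhat j).2 _ (htilde j)
  unfold shiftedErr at e1 e2
  linarith

end Risk

/-! ### The sample size -/

/-- Elementary estimate behind the sample size: with `q = p + 1 ≤ l + 1` moments, the threshold
`t = ε² / (2 K (1 + M + D)²)` for the deviation of the features is admissible. -/
lemma sample_size_bound {n d N p : ℕ} {κ l ε : ℝ} (hn : 1 ≤ n) (hd : 1 ≤ d) (hκ : 0 < κ)
    (hε : 0 < ε) (hl : 1 / 2 ≤ l) (hp : (p : ℝ) ≤ l)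
    (hN : (n : ℝ) * κ ^ 2 * (1000 * l * √((n : ℝ) / d + 1)) ^ (4 * (d + 1)) / ε ^ 4 ≤ N) :
    48 * ((p : ℝ) + 1) ^ 2 * (4 * (144 * (p + 1) * ((n : ℝ) / d + 1)) ^ d) ^ 2
      ≤ N * (ε ^ 2 / (2 * κ)) ^ 2 := by
  have hn' : (1 : ℝ) ≤ n := by exact_mod_cast hn
  set ρ : ℝ := (n : ℝ) / d + 1 with hρ
  have hρ1 : 1 ≤ ρ := by rw [hρ]; exact le_add_of_nonneg_left (by positivity)
  have hsq : √ρ ^ 2 = ρ := Real.sq_sqrt (by linarith)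
  have hx1 : 1 ≤ 1000 * l := by linarith
  have hp3 : (p : ℝ) + 1 ≤ 3 * l := by linarith
  have hx : 144 * ((p : ℝ) + 1) ≤ 1000 * l := by linarith
  have hpow : (1000 * l * √ρ) ^ (4 * (d + 1)) = (1000 * l) ^ (4 * (d + 1)) * ρ ^ (2 * (d + 1)) := by
    rw [mul_pow]
    congr 1
    rw [show 4 * (d + 1) = 2 * (2 * (d + 1)) by ring, pow_mul √ρ, hsq]
  rw [hpow, div_le_iff₀ (by positivity)] at hN
  have h1 : 48 * ((p : ℝ) + 1) ^ 2 * (4 * (144 * (p + 1) * ρ) ^ d) ^ 2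
      ≤ 1 / 4 * ((1000 * l) ^ (4 * (d + 1)) * ρ ^ (2 * (d + 1))) := by
    calc 48 * ((p : ℝ) + 1) ^ 2 * (4 * (144 * (p + 1) * ρ) ^ d) ^ 2
        ≤ 48 * (3 * l) ^ 2 * (4 * (1000 * l * ρ) ^ d) ^ 2 := by gcongr
      _ = 6912 * l ^ 2 * (1000 * l) ^ (2 * d) * ρ ^ (2 * d) := by
          rw [mul_pow (1000 * l) ρ d]
          ring
      _ ≤ 1 / 4 * (1000 * l) ^ 2 * (1000 * l) ^ (2 * d) * ρ ^ (2 * d) := by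
          gcongr ?_ * _ * _
          nlinarith [sq_nonneg l]
      _ = 1 / 4 * ((1000 * l) ^ (2 * d + 2) * ρ ^ (2 * d)) := by ring
      _ ≤ _ := by
          gcongr ?_ * (?_ * ?_)
          · exact pow_le_pow_right₀ hx1 (by omega)
          · exact pow_le_pow_right₀ hρ1 (by omega)
  refine h1.trans ?_
  rw [div_pow, mul_div_assoc', le_div_iff₀ (by positivity)]
  calc 1 / 4 * ((1000 * l) ^ (4 * (d + 1)) * ρ ^ (2 * (d + 1))) * (2 * κ) ^ 2
      = 1 * κ ^ 2 * ((1000 * l) ^ (4 * (d + 1)) * ρ ^ (2 * (d + 1))) := by ring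
    _ ≤ n * κ ^ 2 * ((1000 * l) ^ (4 * (d + 1)) * ρ ^ (2 * (d + 1))) := by gcongr
    _ ≤ N * ε ^ 4 := hN
    _ = _ := by ring

end PiecewiseRegression

theorem mainTheorem7 :
    ∃ C : ℝ, 0 < C ∧
      ∀ (n d K N : ℕ) (σ R D M ε δ : ℝ) (Q₀ : Measure (Vec n)) (c : Fin K → Vec n),
        1 ≤ n → 1 ≤ d → 0 < σ → 0 ≤ M → 0 < ε → 0 < δ → δ < 1 →
        IsProbabilityMeasure Q₀ →
        Q₀ (Metric.closedBall 0 D) = 1 →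
        Function.Injective c →
        IsCompleteWarmStarts Q₀ c R →
        (R / σ) ^ 2 ≤ (d : ℝ) →
        (n : ℝ) * ((K : ℝ) * (1 + M + D) ^ 2) ^ 2
            * (C * Real.log (2 * (K : ℝ) / δ) * √((n : ℝ) / (d : ℝ) + 1)) ^ (4 * (d + 1))
            / ε ^ 4 ≤ (N : ℝ) →
        (∀ b : Fin K → Coeffs n d,
          MemLp (fun y => piecewisePoly c σ b y - posteriorMean Q₀ σ y) 2 (mixtureLaw Q₀ σ)) ∧
        ∀ (Ω : Type*) (mΩ : MeasurableSpace Ω) (Pr : Measure Ω) (S : Fin N → Ω → Vec n × Vec n),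
          IsProbabilityMeasure Pr →
          (∀ i, HasLaw (S i) (denoisingLaw Q₀ σ) Pr) →
          iIndepFun S Pr →
          Pr {ω | ¬ ((∀ j : Fin K, ∀ b ∈ Metric.closedBall (0 : Coeffs n d) M,
                      |shiftedErr Q₀ c σ j (fun i => S i ω) b| ≤ ε ^ 2 / (K : ℝ)) ∧
                    (∀ bhat btilde : Fin K → Coeffs n d,
                      (∀ j, IsERM c σ M j (fun i => S i ω) (bhat j)) →
                      (∀ j, btilde j ∈ Metric.closedBall (0 : Coeffs n d) M) →
                      l2Dist Q₀ c σ bhat ^ 2 - l2Dist Q₀ c σ btilde ^ 2 ≤ ε ^ 2))}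
            ≤ ENNReal.ofReal δ := by
  refine ⟨1000, by norm_num, ?_⟩
  intro n d K N σ R D M ε δ Q₀ c hn hd hσ hM hε hδ hδ1 hQ hD hc hws hR hN
  have hK : 0 < K := by
    rcases Nat.eq_zero_or_pos K with rfl | h
    · simp [IsCompleteWarmStarts] at hws
    · exact h
  have hD0 : 0 ≤ D := by
    by_contra! h
    rw [Metric.closedBall_eq_empty.2 h] at hD
    simp at hD
  refine ⟨memLp_piecewisePoly_sub hd hσ hD hK hc hws hR, ?_⟩
  intro Ω mΩ Pr S hPr hlaw hind
  have hK' : (1 : ℝ) ≤ K := by exact_mod_cast hK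
  set l : ℝ := Real.log (2 * K / δ) with hl
  have harg : 2 ≤ 2 * (K : ℝ) / δ := by
    rw [le_div_iff₀ hδ]
    nlinarith
  have hl2 : 1 / 2 ≤ l := by
    have := Real.log_le_log (by norm_num) harg
    linarith [Real.log_two_gt_d9]
  set κ : ℝ := K * (1 + M + D) ^ 2 with hκ
  have hκ0 : 0 < κ := by positivity
  -- the order `2 (p + 1)` of the moments is of the size of the logarithm of the confidence level
  set p : ℕ := ⌊l⌋₊ with hp
  have hpl : (p : ℝ) ≤ l := Nat.floor_le (by linarith)
  have hlp : l < (p : ℝ) + 1 := Nat.lt_floor_add_one l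
  have hNt := sample_size_bound hn hd hκ0 hε hl2 hpl hN
  have hN0 : 0 < N := by
    have h0 : (0 : ℝ) < N := by
      refine lt_of_lt_of_le ?_ hN
      have : (0 : ℝ) < n := by exact_mod_cast hn
      have : 0 < l := by linarith
      positivity
    exact_mod_cast h0
  set t : ℝ := ε ^ 2 / (2 * κ) with ht
  have ht0 : 0 < t := by positivity
  have hbad : ∀ j, Pr {ω | t < ‖featureDeviation d Q₀ c σ (1 + D) j (fun i => S i ω)‖}
      ≤ ENNReal.ofReal (Real.exp (-((p : ℝ) + 1))) := fun j =>
    measure_featureDeviation_le hN0 hd hσ (by linarith) (by linarith) hD hws hR j hlaw hind p ht0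
      hNt
  refine le_trans (measure_mono (t := ⋃ j, {ω | t <
    ‖featureDeviation d Q₀ c σ (1 + D) j (fun i => S i ω)‖}) fun ω hω => ?_) ?_
  -- off the bad event the error is at most `ε² / (2K)`, so that part two also follows
  · by_contra hcon
    simp only [Set.mem_iUnion, Set.mem_ofPred_eq, not_exists, not_lt] at hcon
    have herr : ∀ j, ∀ b ∈ Metric.closedBall (0 : Coeffs n d) M,
        |shiftedErr Q₀ c σ j (fun i => S i ω) b| ≤ ε ^ 2 / (2 * K) := fun j b hb => by
      rw [mem_closedBall_zero_iff] at hb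
      rw [shiftedErr_eq_inner (s := 1 + D) hN0 hd hσ (by linarith) (by linarith) hD hws hR]
      calc _ ≤ ‖coeffVec (1 + D) b‖ * ‖featureDeviation d Q₀ c σ (1 + D) j (fun i => S i ω)‖ :=
            abs_real_inner_le_norm _ _
        _ ≤ (M + (1 + D)) ^ 2 * t := by
            gcongr
            · exact (norm_coeffVec_le (by linarith) b).trans (by gcongr)
            · exact hcon j
        _ = ε ^ 2 / (2 * K) := by
            rw [ht, hκ, show M + (1 + D) = 1 + M + D by ring]
            have : 1 + M + D ≠ 0 := by positivity
            field_simp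
    refine hω ⟨fun j b hb => (herr j b hb).trans ?_, fun bhat btilde hhat htilde => ?_⟩
    · gcongr
      linarith
    · refine (l2Dist_sq_sub_le hd hσ hD hK hc hws hR herr hhat htilde).trans (le_of_eq ?_)
      field_simp
  · calc _ ≤ ∑ j, Pr {ω | t < ‖featureDeviation d Q₀ c σ (1 + D) j (fun i => S i ω)‖} :=
          measure_iUnion_fintype_le _ _
      _ ≤ ∑ _j : Fin K, ENNReal.ofReal (Real.exp (-((p : ℝ) + 1))) :=
          Finset.sum_le_sum fun j _ => hbad j
      _ = ENNReal.ofReal (K * Real.exp (-((p : ℝ) + 1))) := by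
          rw [ENNReal.ofReal_mul (by positivity), ENNReal.ofReal_natCast]
          simp
      _ ≤ ENNReal.ofReal δ := by
          refine ENNReal.ofReal_le_ofReal ?_
          have h1 : Real.exp (-((p : ℝ) + 1)) ≤ Real.exp (-l) := by
            gcongr
          rw [Real.exp_neg l, hl, Real.exp_log (by positivity), inv_div] at h1
          calc (K : ℝ) * Real.exp (-((p : ℝ) + 1)) ≤ K * (δ / (2 * K)) := by gcongr
            _ = δ / 2 := by field_simp
            _ ≤ δ := by linarith
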